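/- **Setting.** Let $N=\mathbb Z^n$ be a lattice of rank $n$, $V=N\otimes\mathbb R=\mathbb R^n$, and let $N^*=\operatorname{Hom}(N,\mathbb Z)\subset V^*$ be the dual lattice. The volume element $dV^*$ on $V^*$ is normalized so that the unit cube of a basis of $N^*$ has volume $1$. A *simplicial multi-fan* $\Delta=(\Sigma,C,w^\pm)$ in $N$ consists of a simplicial complex $\Sigma$ (containing $\emptyset$) on the vertex set $\{1,\dots,d\}$, every $i$ being a vertex; primitive vectors $v_1,\dots,v_d\in N$ such that $\{v_i\}_{i\in I}$ is linearly independent for each $I\in\Sigma$, with $C(I)$ the cone spanned by $\{v_i\}_{i\in I}$; and functions $w^\pm:\Sigma^{(n)}\to\mathbb Z_{\ge0}$ on $\Sigma^{(n)}=\{I\in\Sigma: |I|=n\}$ such that $w^+(I)>0$ or $w^-(I)>0$ for every $I$. Put $w=w^+-w^-$. For $K\in\Sigma$ let $\Delta_K$ be the collection of the images of the cones $C(J)$, $K\subseteq J\in\Sigma$, in $V_K=V/\operatorname{span}C(K)$. A vector of $V_K$ is *generic* if it lies in the span of none of these images with $|J|<n$. $\Delta$ is *complete* if for every $K\in\Sigma$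 (including $K=\emptyset$) some $J\in\Sigma^{(n)}$ contains $K$ and the sum of $w(J)$ over those $J\in\Sigma^{(n)}$ with $K\subseteq J$ for which the image of $C(J)$ contains $\bar x$ is the same for all generic $\bar x\in V_K$. A *simple multi-polytope* $\mathcal P=(\Delta,\mathcal F)$ is a complete simplicial multi-fan $\Delta$ with affine hyperplanes $F_i=\{u\in V^*:\langle u,v_i\rangle=c_i\}$, $c_i\in\mathbb R$, $i=1,\dots,d$. For $I\in\Sigma^{(n)}$ let $u_I$ be the point $\bigcap_{i\in I}F_i$ and $\{u_i^I\}_{i\in I}$ the basis of $V^*$ dual to $\{v_i\}_{i\in I}$. $\mathcal P$ is a *lattice* multi-polytope if $u_I\in N^*$ for all $I\in\Sigma^{(n)}$. For $h\in\mathbb R^d$ let $\mathcal P_h$ be the multi-polytope obtained by replacing each $c_i$ by $c_i+h_i$. Choose a generic $x\in V$ (the case $K=\emptyset$). Let $(-1)^I=(-1)^{\#\{i\in I:\langle u_i^I,x\rangle>0\}}$, let $(u_i^I)^+=\pm u_i^I$ with the sign that makes it positive on $x$, and let $\phi_I$ be the characteristic function of the cone with apex $u_I$ spanned by the $(u_i^I)^+$,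 $i\in I$. The *Duistermaat–Heckman function* is $\mathrm{DH}_{\mathcal P}=\sum_{I\in\Sigma^{(n)}}(-1)^Iw(I)\phi_I$ on $V^*\setminus\bigcup_iF_i$. Put $$\operatorname{vol}(\mathcal P)=\int_{V^*}\mathrm{DH}_{\mathcal P}\,dV^*,\qquad \sharp(\mathcal P)=\sum_{u\in N^*}\mathrm{DH}_{\mathcal P_+}(u),$$ where $\mathcal P$ is a lattice multi-polytope in the second formula and $\mathcal P_+=\mathcal P_\varepsilon$ for any $\varepsilon\in\mathbb R^d$ with $0<\varepsilon_i<1$ for all $i$. For $I\in\Sigma^{(n)}$ let $G_I\subset\mathbb R^d/\mathbb Z^d$ be the finite group of the classes of all $a\in\mathbb R^d$ with $\sum_ia_iv_i\in N$ and $a_j=0$ for $j\notin I$; let $G_\Delta=\bigcup_{I\in\Sigma^{(n)}}G_I$ and $\rho_i([a])=e^{2\pi\sqrt{-1}\,a_i}$. The *Todd operator* is $$\mathcal T(\partial/\partial h)=\sum_{g\in G_\Delta}\prod_{i=1}^d\frac{\partial/\partial h_i}{1-\rho_i(g)e^{-\partial/\partial h_i}},$$ expanded as a power series in the $\partial/\partial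 h_i$ (each factor being the Maclaurin series of $t/(1-\rho_i(g)e^{-t})$) and acting on polynomials in $h_1,\dots,h_d$. **Theorem 8.7** (generalized Khovanskii–Pukhlikov formula). Let $\mathcal P$ be a simple lattice multi-polytope. Then the integral defining $\operatorname{vol}(\mathcal P_h)$ converges absolutely for every $h\in\mathbb R^d$, only finitely many terms of the sum defining $\sharp(\mathcal P)$ are nonzero, neither $\operatorname{vol}(\mathcal P_h)$ nor $\sharp(\mathcal P)$ depends on the choices of $x$ and $\varepsilon$, $\operatorname{vol}(\mathcal P_h)$ is a polynomial in $h_1,\dots,h_d$, and $$\mathcal T(\partial/\partial h)\operatorname{vol}(\mathcal P_h)\big|_{h=0}=\sharp(\mathcal P).$$ -/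

import Mathlib

open scoped Matrix

noncomputable section

/-- A simplicial multi-fan `(Σ, C, w⁺, w⁻)` in the lattice `N = ℤⁿ`, with `N_ℝ = ℝⁿ`, whose
one-dimensional cones are labelled by `Fin d`.  `Sig` is an augmented simplicial set on the vertex
set `Fin d`, every `i : Fin d` being a vertex; `v i` is the primitive lattice vector of the ray
`C {i}`; the cone `C I` is the one spanned by the `v i`, `i ∈ I`.  The weights `wPlus`, `wMinus`
matter only on the `I ∈ Sig` with `n` elements. -/
structure SimplicialMultiFan (n d : ℕ) where
  Sig : Finset (Finset (Fin d))
  empty_mem : ∅ ∈ Sig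
  singleton_mem : ∀ i : Fin d, {i} ∈ Sig
  down_closed : ∀ I ∈ Sig, ∀ J ⊆ I, J ∈ Sig
  v : Fin d → (Fin n → ℤ)
  primitive : ∀ (i : Fin d) (k : ℤ) (x : Fin n → ℤ), v i = k • x → IsUnit k
  linearIndependent : ∀ I ∈ Sig,
    LinearIndependent ℝ (fun i : {i // i ∈ I} => (fun k => (v i.1 k : ℝ) : Fin n → ℝ))
  wPlus : Finset (Fin d) → ℕ
  wMinus : Finset (Fin d) → ℕ
  weight_pos : ∀ I ∈ Sig, I.card = n → 0 < wPlus I ∨ 0 < wMinus I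

namespace SimplicialMultiFan

variable {n d : ℕ}

/-- `v_i` as a vector of `N_ℝ = ℝⁿ`. -/
def vR (Δ : SimplicialMultiFan n d) (i : Fin d) : Fin n → ℝ := fun k => (Δ.v i k : ℝ)

/-- `w = w⁺ - w⁻`. -/
def w (Δ : SimplicialMultiFan n d) (I : Finset (Fin d)) : ℤ := (Δ.wPlus I : ℤ) - Δ.wMinus I

/-- `Σ⁽ⁿ⁾`, the labels of the cones of dimension `n`. -/
def top (Δ : SimplicialMultiFan n d) : Finset (Finset (Fin d)) :=
  Δ.Sig.filter (fun I => I.card = n)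

/-- The cone `C(I)` spanned by the `v_i`, `i ∈ I`. -/
def cone (Δ : SimplicialMultiFan n d) (I : Finset (Fin d)) : Set (Fin n → ℝ) :=
  {x | ∃ r : Fin d → ℝ, (∀ i, 0 ≤ r i) ∧ x = ∑ i ∈ I, r i • Δ.vR i}

/-- A vector is generic if it lies in no linear subspace spanned by a cone of dimension `< n`. -/
def IsGeneric (Δ : SimplicialMultiFan n d) (x : Fin n → ℝ) : Prop :=
  ∀ J ∈ Δ.Sig, J.card < n → x ∉ Submodule.span ℝ (Δ.cone J)

/-- The space `N_ℝ / span C(K)` in which the projected multi-fan `Δ_K` lives. -/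
abbrev ProjSpace (Δ : SimplicialMultiFan n d) (K : Finset (Fin d)) : Type :=
  (Fin n → ℝ) ⧸ Submodule.span ℝ (Δ.cone K)

/-- The cone `C_K(J)` of the projected multi-fan `Δ_K`: the image of `C(J)`. -/
def projCone (Δ : SimplicialMultiFan n d) (K J : Finset (Fin d)) : Set (Δ.ProjSpace K) :=
  (Submodule.span ℝ (Δ.cone K)).mkQ '' Δ.cone J

/-- Generic vectors for the projected multi-fan `Δ_K`, whose cone labelled by `J ⊇ K` has
dimension `|J| - |K|`, the ambient dimension being `n - |K|`. -/
def IsProjGeneric (Δ : SimplicialMultiFan n d) (K : Finset (Fin d)) (x : Δ.ProjSpace K) : Prop :=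
  ∀ J ∈ Δ.Sig, K ⊆ J → J.card < n → x ∉ Submodule.span ℝ (Δ.projCone K J)

open Classical in
/-- The integer `d_x` of the projected multi-fan `Δ_K`: the sum of the weights of its top
dimensional cones that contain `x`. -/
def projDeg (Δ : SimplicialMultiFan n d) (K : Finset (Fin d)) (x : Δ.ProjSpace K) : ℤ :=
  ∑ J ∈ Δ.top.filter (fun J => K ⊆ J ∧ x ∈ Δ.projCone K J), Δ.w J

/-- The projected multi-fan `Δ_K` is pre-complete: it has a top dimensional cone and `d_x` does not
depend on the generic vector `x`. -/
def IsPreCompleteAt (Δ : SimplicialMultiFan n d) (K : Finset (Fin d)) : Prop :=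
  (∃ J ∈ Δ.top, K ⊆ J) ∧
    ∃ D : ℤ, ∀ x : Δ.ProjSpace K, Δ.IsProjGeneric K x → Δ.projDeg K x = D

/-- Completeness: `Δ_K` is pre-complete for every `K ∈ Σ`; `K = ∅` gives `Δ` itself. -/
def IsComplete (Δ : SimplicialMultiFan n d) : Prop := ∀ K ∈ Δ.Sig, Δ.IsPreCompleteAt K

/-- `⟨e i, v_j⟩ = δ_ij` for `i, j ∈ I`.  The dual space of `N_ℝ` is identified with `ℝⁿ` by the
dot product, so that the dual lattice `N*` is `ℤⁿ`. -/
def IsDualFamily (Δ : SimplicialMultiFan n d) (I : Finset (Fin d)) (e : Fin d → (Fin n → ℝ)) :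
    Prop :=
  ∀ i ∈ I, ∀ j ∈ I, e i ⬝ᵥ Δ.vR j = if i = j then 1 else 0

open Classical in
/-- `dualVec I i = u_i^I`, the basis dual to `(v_i)_{i ∈ I}`, for `I ∈ Σ⁽ⁿ⁾` and `i ∈ I`. -/
def dualVec (Δ : SimplicialMultiFan n d) (I : Finset (Fin d)) : Fin d → (Fin n → ℝ) :=
  if h : ∃ e, Δ.IsDualFamily I e then h.choose else 0

theorem dualVec_spec (Δ : SimplicialMultiFan n d) {I : Finset (Fin d)} (hI : I ∈ Δ.Sig) :
    Δ.IsDualFamily I (Δ.dualVec I) := by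
  classical
  have h : ∃ e, Δ.IsDualFamily I e := by
    have hli := Δ.linearIndependent I hI
    have key : ∀ i : {i // i ∈ I}, ∃ f : (Fin n → ℝ) →ₗ[ℝ] ℝ,
        ∀ j : {i // i ∈ I}, f (Δ.vR j.1) = if i = j then 1 else 0 := by
      intro i
      obtain ⟨f, hf⟩ := (((Module.Basis.span hli).coord i)).exists_extend
      refine ⟨f, fun j => ?_⟩
      have h1 : f (Δ.vR j.1) = (f.comp (Submodule.subtype _)) ((Module.Basis.span hli) j) := by
        simp [Module.Basis.span_apply]
        rfl
      rw [h1, hf]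
      simp [Module.Basis.coord_apply, Finsupp.single_apply, eq_comm]
    choose f hf using key
    refine ⟨fun i => if hi : i ∈ I then fun k => f ⟨i, hi⟩ (Pi.single k 1) else 0, ?_⟩
    intro i hi j hj
    have h2 := hf ⟨i, hi⟩ ⟨j, hj⟩
    rw [LinearMap.pi_apply_eq_sum_univ] at h2
    simp only [Subtype.mk.injEq] at h2
    rw [← h2]
    simp only [dif_pos hi, dotProduct, smul_eq_mul]
    refine Finset.sum_congr rfl fun k _ => ?_
    rw [mul_comm]
    congr 2
    ext l
    simp [Pi.single_apply, eq_comm]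
  rw [dualVec, dif_pos h]
  exact h.choose_spec

/-- `G_I ⊂ ℝᵈ/ℤᵈ`: classes of the `a` with `∑ a_i v_i ∈ N` and `a_j = 0` for `j ∉ I`. -/
def G (Δ : SimplicialMultiFan n d) (I : Finset (Fin d)) : Set (Fin d → AddCircle (1 : ℝ)) :=
  {g | ∃ a : Fin d → ℝ, (∃ x : Fin n → ℤ, ∑ i, a i • Δ.vR i = fun k => (x k : ℝ)) ∧
    (∀ j, j ∉ I → a j = 0) ∧ g = fun i => (a i : AddCircle (1 : ℝ))}

/-- `G_Δ`, the union of the finite groups `G_I`, `I ∈ Σ⁽ⁿ⁾`. -/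
def GAll (Δ : SimplicialMultiFan n d) : Set (Fin d → AddCircle (1 : ℝ)) :=
  ⋃ I ∈ Δ.top, Δ.G I

end SimplicialMultiFan

/-- `ρ_i([a]) = exp(2π√-1 a_i)`. -/
def rho {d : ℕ} (i : Fin d) (g : Fin d → AddCircle (1 : ℝ)) : ℂ := (AddCircle.toCircle (g i) : ℂ)

/-- The power series `e^{-X}`. -/
def expNeg : PowerSeries ℂ := PowerSeries.mk fun k => (-1) ^ k / (k.factorial : ℂ)

open Classical in
/-- The Maclaurin series of `x / (1 - ρ e^{-x})`.  For `ρ = 1` the denominator is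
`X * ∑ (-1)^k X^k / (k+1)!`. -/
def toddSeries (ρ : ℂ) : PowerSeries ℂ :=
  if ρ = 1 then (PowerSeries.mk fun k => (-1) ^ k / ((k + 1).factorial : ℂ))⁻¹
  else PowerSeries.X * (1 - PowerSeries.C ρ * expNeg)⁻¹

theorem toddSeries_spec (ρ : ℂ) :
    toddSeries ρ * (1 - PowerSeries.C ρ * expNeg) = PowerSeries.X := by
  unfold toddSeries
  split_ifs with h
  · subst h
    have h1 : (1 - PowerSeries.C (1 : ℂ) * expNeg) =
        (PowerSeries.mk fun k => (-1) ^ k / ((k + 1).factorial : ℂ)) * PowerSeries.X := by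
      ext k
      cases k with
      | zero => simp [expNeg]
      | succ k =>
        rw [PowerSeries.coeff_succ_mul_X]
        simp [expNeg, PowerSeries.coeff_one, pow_succ, neg_div]
    rw [h1, ← mul_assoc, PowerSeries.inv_mul_cancel, one_mul]
    simp
  · rw [mul_assoc, PowerSeries.inv_mul_cancel, mul_one]
    simp only [expNeg, map_sub, map_mul, PowerSeries.constantCoeff_one, PowerSeries.constantCoeff_C, ne_eq,
      PowerSeries.constantCoeff_mk]
    simpa [sub_eq_zero] using fun h' : (1 : ℂ) = ρ => h h'.symm

/-- The partial derivative `∂^α = ∏ (∂/∂h_i)^{α_i}` of a polynomial in `h_1, …, h_d`. -/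
def multiDeriv {d : ℕ} (α : Fin d → ℕ) (p : MvPolynomial (Fin d) ℂ) : MvPolynomial (Fin d) ℂ :=
  (List.finRange d).foldr (fun i q => (fun r => MvPolynomial.pderiv i r)^[α i] q) p

/-- The Todd operator `∑_{g ∈ G_Δ} ∏_i (∂/∂h_i) / (1 - ρ_i(g) e^{-∂/∂h_i})` on polynomials in
`h_1, …, h_d`: the coefficient of `∂^α` in the product is the product over `i` of the
`α_i`-th Maclaurin coefficients.  Only finitely many `∂^α p` are nonzero. -/
def toddOperator {n d : ℕ} (Δ : SimplicialMultiFan n d) (p : MvPolynomial (Fin d) ℂ) :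
    MvPolynomial (Fin d) ℂ :=
  ∑ᶠ g ∈ Δ.GAll, ∑ᶠ α : Fin d → ℕ,
    (∏ i, PowerSeries.coeff (α i) (toddSeries (rho i g))) • multiDeriv α p

/-- A simple multi-polytope `(Δ, F)`: a complete simplicial multi-fan and, for each `i`, the affine
hyperplane `F_i = {u | ⟨u, v_i⟩ = c_i}` perpendicular to the ray `C {i}`. -/
structure SimpleMultiPolytope (n d : ℕ) where
  fan : SimplicialMultiFan n d
  complete : fan.IsComplete
  c : Fin d → ℝ

namespace SimpleMultiPolytope

variable {n d : ℕ}

/-- The affine hyperplane `F_i` in the dual space of `N_ℝ`. -/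
def hyperplane (P : SimpleMultiPolytope n d) (i : Fin d) : Set (Fin n → ℝ) :=
  {u | u ⬝ᵥ P.fan.vR i = P.c i}

/-- `P_h`, with `c_i` replaced by `c_i + h_i`: the hyperplane `F_i` is moved in the direction of
`v_i` if `h_i > 0`. -/
def shift (P : SimpleMultiPolytope n d) (h : Fin d → ℝ) : SimpleMultiPolytope n d where
  fan := P.fan
  complete := P.complete
  c := fun i => P.c i + h i

/-- The vertex `u_I`, for `I ∈ Σ⁽ⁿ⁾`: the point at which the `F_i`, `i ∈ I`, meet. -/
def vertex (P : SimpleMultiPolytope n d) (I : Finset (Fin d)) : Fin n → ℝ :=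
  ∑ i ∈ I, P.c i • P.fan.dualVec I i

theorem vertex_mem (P : SimpleMultiPolytope n d) {I : Finset (Fin d)} (hI : I ∈ P.fan.Sig)
    {j : Fin d} (hj : j ∈ I) : P.vertex I ∈ P.hyperplane j := by
  have h := P.fan.dualVec_spec hI
  have h1 : ∀ i ∈ I, (P.c i • P.fan.dualVec I i) ⬝ᵥ P.fan.vR j = if i = j then P.c i else 0 := by
    intro i hi
    rw [smul_dotProduct, h i hi j hj]
    simp
  simp only [hyperplane, vertex, Set.mem_ofPred_eq, sum_dotProduct]
  rw [Finset.sum_congr rfl h1]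
  simp [hj]

/-- `P` is a lattice multi-polytope: all its vertices are in `N* = ℤⁿ`. -/
def IsLattice (P : SimpleMultiPolytope n d) : Prop :=
  ∀ I ∈ P.fan.top, ∃ u : Fin n → ℤ, P.vertex I = fun k => (u k : ℝ)

open Classical in
/-- `(u_i^I)⁺`, which is `u_i^I` or `-u_i^I`, positive on the generic vector `x`. -/
def dualVecPlus (P : SimpleMultiPolytope n d) (x : Fin n → ℝ) (I : Finset (Fin d)) (i : Fin d) :
    Fin n → ℝ :=
  if 0 < P.fan.dualVec I i ⬝ᵥ x then P.fan.dualVec I i else -P.fan.dualVec I i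

/-- The cone `C*(I)⁺` with apex `u_I` spanned by the `(u_i^I)⁺`, `i ∈ I`. -/
def dualCone (P : SimpleMultiPolytope n d) (x : Fin n → ℝ) (I : Finset (Fin d)) :
    Set (Fin n → ℝ) :=
  {u | ∃ r : Fin d → ℝ, (∀ i, 0 ≤ r i) ∧
    u = P.vertex I + ∑ i ∈ I, r i • P.dualVecPlus x I i}

open Classical in
/-- The Duistermaat-Heckman function `∑_{I ∈ Σ⁽ⁿ⁾} (-1)^I w(I) φ_I` computed with the generic vector
`x`, where `(-1)^I = (-1)^#{i ∈ I | ⟨u_i^I, x⟩ > 0}`; it is meant off the hyperplanes `F_i`. -/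
def DH (P : SimpleMultiPolytope n d) (x : Fin n → ℝ) (u : Fin n → ℝ) : ℤ :=
  ∑ I ∈ P.fan.top, (-1) ^ (I.filter (fun i => 0 < P.fan.dualVec I i ⬝ᵥ x)).card * P.fan.w I *
    (if u ∈ P.dualCone x I then 1 else 0)

/-- `vol(P)`, the integral of `DH_P` for the Lebesgue measure of `ℝⁿ`, for which the unit cube of
the dual lattice `ℤⁿ` has volume 1.  (The hyperplanes `F_i` are negligible.) -/
def vol (P : SimpleMultiPolytope n d) (x : Fin n → ℝ) : ℝ :=
  ∫ u : Fin n → ℝ, (P.DH x u : ℝ)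

/-- `DH_P` restricted to the dual lattice `N* = ℤⁿ`. -/
def latticeDH (P : SimpleMultiPolytope n d) (x : Fin n → ℝ) (u : Fin n → ℤ) : ℤ :=
  P.DH x (fun k => (u k : ℝ))

/-- `♯(P)`, the sum over the dual lattice of `DH` of `P₊`; here `P₊ = P_ε` is obtained by moving
each `F_i` by a small `ε_i > 0` in the direction of `v_i`. -/
def count (P : SimpleMultiPolytope n d) (x : Fin n → ℝ) (ε : Fin d → ℝ) : ℤ :=
  ∑ᶠ u : Fin n → ℤ, (P.shift ε).latticeDH x u

end SimpleMultiPolytope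

end

/-! Fix a generic `x` and put b_i = ⟨u_i^I, x⟩. In the coordinates ⟨u, v_i⟩ - c_i, i ∈ I, the
contribution of I to DH is w(I) times a product of signed half-lines (`DH_eq`). Off its endpoint, a
signed half-line is a function of u plus a function of x, so expanding the product over subsets K ⊆
I and regrouping by K writes DH in terms of the degrees of the projected multi-fans Δ_K at x
(`DH_eq_sum_projDeg`). Completeness makes these degrees constant. Hence DH does not depend on x off
the hyperplanes (`DH_eq_of_isGeneric`). Comparing x with -x and letting x run over the generic
vectors, which span V, bounds the support (`exists_norm_le`). This gives integrability and, for a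
lattice multi-polytope, a finite sum.

Both sides of the formula are then computed by localization at the vertices. Weight DH by e^{t⟨u,x⟩}
with t < 0, so that every vertex cone contributes separately. The integral over a cone factors into
one-variable integrals and gives e^{t⟨u_I,x⟩} / (|G_I| ∏ t b_i) (`IsGeneric.integral_cone`). The sum
over N* becomes a sum of products of geometric series after averaging over the characters of G_I,
and gives |G_I|⁻¹ ∑_{g ∈ G_I} e^{t⟨u_I,x⟩} ∏ 1/(1 - ρ_i(g) e^{-t b_i}) (`IsGeneric.hasSum_cone`).
Single vertices have poles at t = 0, but the totals tend to vol and ♯ as t → 0⁻. So both numbers are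
t^n-coefficients of asymptotic expansions (`HasAsymp.eq_coeff_of_tendsto`, `vol_eq`,
`IsLattice.count_eq`).

In particular vol(P_h) is a combination of n-th powers of affine forms in h. The Todd operator acts
on such a power and returns at h = 0 a t^n-coefficient of Todd series times an exponential
(`eval_zero_finsum_multiDeriv`). The factors with i ∉ I reduce the sum over G_Δ to one over G_I
(`prod_rescale_toddSeries`), and the two expressions agree vertex by vertex. -/

section

open Finset

/-! ### Dual bases, generic vectors and projected cones. -/

namespace SimplicialMultiFan

variable {n d : ℕ} (Δ : SimplicialMultiFan n d) {I : Finset (Fin d)}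

theorem mem_Sig_of_mem_top (hI : I ∈ Δ.top) : I ∈ Δ.Sig := (mem_filter.1 hI).1

theorem card_of_mem_top (hI : I ∈ Δ.top) : I.card = n := (mem_filter.1 hI).2

theorem dualVec_dotProduct_sum (hI : I ∈ Δ.Sig) (r : Fin d → ℝ) {j : Fin d} (hj : j ∈ I) :
    Δ.dualVec I j ⬝ᵥ (∑ i ∈ I, r i • Δ.vR i) = r j := by
  have h := Δ.dualVec_spec hI
  rw [dotProduct_sum]
  rw [sum_congr rfl (g := fun i => if j = i then r i else 0)]
  · simp [hj]
  · intro i hi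
    rw [dotProduct_smul, h j hj i hi]
    simp

theorem sum_dualVec_dotProduct (hI : I ∈ Δ.Sig) (r : Fin d → ℝ) {j : Fin d} (hj : j ∈ I) :
    (∑ i ∈ I, r i • Δ.dualVec I i) ⬝ᵥ Δ.vR j = r j := by
  have h := Δ.dualVec_spec hI
  rw [sum_dotProduct]
  rw [sum_congr rfl (g := fun i => if i = j then r i else 0)]
  · simp [hj]
  · intro i hi
    rw [smul_dotProduct, h i hi j hj]
    simp

theorem exists_eq_sum_of_mem_top (hI : I ∈ Δ.top) (x : Fin n → ℝ) :
    ∃ r : Fin d → ℝ, x = ∑ i ∈ I, r i • Δ.vR i := by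
  classical
  have hli := Δ.linearIndependent I (Δ.mem_Sig_of_mem_top hI)
  have hsp := hli.span_eq_top_of_card_eq_finrank' (by simp [Δ.card_of_mem_top hI])
  have hx : x ∈ Submodule.span ℝ (Set.range fun i : {i // i ∈ I} => Δ.vR i.1) := by
    change x ∈ Submodule.span ℝ (Set.range fun i : {i // i ∈ I} => (fun k => (Δ.v i.1 k : ℝ)))
    rw [hsp]; trivial
  obtain ⟨c, hc⟩ := (Submodule.mem_span_range_iff_exists_fun ℝ).1 hx
  refine ⟨fun i => if h : i ∈ I then c ⟨i, h⟩ else 0, ?_⟩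
  rw [← hc, ← Finset.sum_coe_sort I]
  exact Finset.sum_congr rfl fun i _ => by simp

theorem eq_sum_dualVec_dotProduct_smul (hI : I ∈ Δ.top) (x : Fin n → ℝ) :
    x = ∑ i ∈ I, (Δ.dualVec I i ⬝ᵥ x) • Δ.vR i := by
  obtain ⟨r, hr⟩ := Δ.exists_eq_sum_of_mem_top hI x
  conv_lhs => rw [hr]
  refine sum_congr rfl fun i hi => ?_
  rw [hr, Δ.dualVec_dotProduct_sum (Δ.mem_Sig_of_mem_top hI) r hi]

theorem dotProduct_eq_sum (hI : I ∈ Δ.top) (u x : Fin n → ℝ) :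
    u ⬝ᵥ x = ∑ i ∈ I, (Δ.dualVec I i ⬝ᵥ x) * (u ⬝ᵥ Δ.vR i) := by
  conv_lhs => rw [Δ.eq_sum_dualVec_dotProduct_smul hI x]
  rw [dotProduct_sum]
  exact sum_congr rfl fun i _ => by rw [dotProduct_smul, smul_eq_mul]

theorem eq_of_dotProduct_vR_eq (hI : I ∈ Δ.top) {u u' : Fin n → ℝ}
    (h : ∀ i ∈ I, u ⬝ᵥ Δ.vR i = u' ⬝ᵥ Δ.vR i) : u = u' := by
  refine dotProduct_eq u u' fun x => ?_
  rw [Δ.dotProduct_eq_sum hI, Δ.dotProduct_eq_sum hI u']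
  exact sum_congr rfl fun i hi => by rw [h i hi]

theorem vR_mem_cone {i : Fin d} (hi : i ∈ I) : Δ.vR i ∈ Δ.cone I :=
  ⟨Pi.single i 1, fun j => by
    by_cases h : j = i
    · subst h; simp
    · simp [h], by
    rw [sum_eq_single i (fun j _ hj => by simp [hj]) (fun h => absurd hi h)]
    simp⟩

theorem cone_subset_span (J : Finset (Fin d)) :
    Δ.cone J ⊆ Submodule.span ℝ (Δ.vR '' (J : Set (Fin d))) := by
  rintro x ⟨r, -, rfl⟩
  exact Submodule.sum_mem _ fun i hi =>
    Submodule.smul_mem _ _ (Submodule.subset_span (Set.mem_image_of_mem _ hi))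

theorem span_cone (J : Finset (Fin d)) :
    Submodule.span ℝ (Δ.cone J) = Submodule.span ℝ (Δ.vR '' (J : Set (Fin d))) := by
  apply le_antisymm
  · exact Submodule.span_le.2 (Δ.cone_subset_span J)
  · refine Submodule.span_mono ?_
    rintro _ ⟨i, hi, rfl⟩
    exact Δ.vR_mem_cone hi

theorem span_cone_mono {K J : Finset (Fin d)} (h : K ⊆ J) :
    Submodule.span ℝ (Δ.cone K) ≤ Submodule.span ℝ (Δ.cone J) := by
  rw [span_cone, span_cone]
  exact Submodule.span_mono (Set.image_mono (by exact_mod_cast h))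

theorem dualVec_dotProduct_eq_zero_of_mem_span (hI : I ∈ Δ.Sig) {K : Finset (Fin d)} (hK : K ⊆ I)
    {i : Fin d} (hi : i ∈ I) (hiK : i ∉ K) {y : Fin n → ℝ}
    (hy : y ∈ Submodule.span ℝ (Δ.cone K)) : Δ.dualVec I i ⬝ᵥ y = 0 := by
  rw [span_cone] at hy
  induction hy using Submodule.span_induction with
  | mem z hz =>
    obtain ⟨j, hj, rfl⟩ := hz
    rw [Δ.dualVec_spec hI i hi j (hK hj), if_neg]
    rintro rfl
    exact hiK hj
  | zero => simp
  | add a b _ _ ha hb => rw [dotProduct_add, ha, hb, add_zero]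
  | smul c a _ ha => rw [dotProduct_smul, ha, smul_zero]

theorem IsGeneric.dualVec_dotProduct_ne_zero {Δ : SimplicialMultiFan n d} {x : Fin n → ℝ}
    (hx : Δ.IsGeneric x)
    (hI : I ∈ Δ.top) {i : Fin d} (hi : i ∈ I) : Δ.dualVec I i ⬝ᵥ x ≠ 0 := by
  intro h0
  refine hx (I.erase i) (Δ.down_closed I (Δ.mem_Sig_of_mem_top hI) _ (erase_subset _ _)) ?_ ?_
  · rw [← Δ.card_of_mem_top hI]
    exact card_erase_lt_of_mem hi
  · rw [Δ.eq_sum_dualVec_dotProduct_smul hI x, ← sum_erase_add _ _ hi, h0, zero_smul, add_zero,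
      span_cone]
    exact Submodule.sum_mem _ fun j hj =>
      Submodule.smul_mem _ _ (Submodule.subset_span (Set.mem_image_of_mem _ hj))

/-- For K ⊆ J the span of C(J) contains that of C(K), so it is the full preimage of the span of the
projected cone. -/
theorem IsGeneric.isProjGeneric {Δ : SimplicialMultiFan n d} {x : Fin n → ℝ} (hx : Δ.IsGeneric x)
    (K : Finset (Fin d)) :
    Δ.IsProjGeneric K ((Submodule.span ℝ (Δ.cone K)).mkQ x) := by
  intro J hJ hKJ hcard hmem
  rw [projCone, Submodule.span_image] at hmem
  obtain ⟨y, hy, hyx⟩ := hmem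
  refine hx J hJ hcard ?_
  have h1 : x - y ∈ Submodule.span ℝ (Δ.cone K) := by
    rw [← Submodule.ker_mkQ (Submodule.span ℝ (Δ.cone K)), LinearMap.mem_ker, map_sub, hyx,
      sub_self]
  have h2 := Submodule.add_mem _ (Δ.span_cone_mono hKJ h1) hy
  rwa [sub_add_cancel] at h2

/-- Modulo the span of C(K) only the coordinates with index in I \ K survive; genericity turns their
nonnegativity into positivity. -/
theorem IsGeneric.mkQ_mem_projCone_iff {Δ : SimplicialMultiFan n d} {x : Fin n → ℝ}
    (hx : Δ.IsGeneric x) (hI : I ∈ Δ.top)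
    {K : Finset (Fin d)} (hK : K ⊆ I) :
    (Submodule.span ℝ (Δ.cone K)).mkQ x ∈ Δ.projCone K I ↔
      ∀ i ∈ I \ K, 0 < Δ.dualVec I i ⬝ᵥ x := by
  classical
  constructor
  · rintro ⟨y, ⟨r, hr, rfl⟩, hyx⟩ i hi
    rw [mem_sdiff] at hi
    have h1 : x - (∑ i ∈ I, r i • Δ.vR i) ∈ Submodule.span ℝ (Δ.cone K) := by
      rw [← Submodule.ker_mkQ (Submodule.span ℝ (Δ.cone K)), LinearMap.mem_ker, map_sub, hyx,
        sub_self]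
    have h2 := Δ.dualVec_dotProduct_eq_zero_of_mem_span (Δ.mem_Sig_of_mem_top hI) hK hi.1 hi.2 h1
    rw [dotProduct_sub, Δ.dualVec_dotProduct_sum (Δ.mem_Sig_of_mem_top hI) r hi.1] at h2
    refine lt_of_le_of_ne ?_ (hx.dualVec_dotProduct_ne_zero hI hi.1).symm
    linarith [hr i]
  · intro h
    -- The lift is `x` with its K-coordinates erased. The `max 0` changes nothing on I \ K; it only
    -- supplies nonnegative coefficients at indices outside I.
    refine ⟨∑ i ∈ I, (if i ∈ K then 0 else max 0 (Δ.dualVec I i ⬝ᵥ x)) • Δ.vR i,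
      ⟨_, fun i => ?_, rfl⟩, ?_⟩
    · split_ifs
      · exact le_rfl
      · exact le_max_left _ _
    · rw [← sub_eq_zero, ← map_sub, ← LinearMap.mem_ker, Submodule.ker_mkQ]
      have hxs := Δ.eq_sum_dualVec_dotProduct_smul hI x
      have h1 : ∑ i ∈ I, (if i ∈ K then 0 else max 0 (Δ.dualVec I i ⬝ᵥ x)) • Δ.vR i - x =
          ∑ i ∈ I, ((if i ∈ K then 0 else max 0 (Δ.dualVec I i ⬝ᵥ x)) - Δ.dualVec I i ⬝ᵥ x) •
            Δ.vR i := by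
        simp only [sub_smul, sum_sub_distrib]
        rw [← hxs]
      rw [h1, span_cone]
      refine Submodule.sum_mem _ fun i hi => ?_
      by_cases hiK : i ∈ K
      · exact Submodule.smul_mem _ _ (Submodule.subset_span (Set.mem_image_of_mem _ hiK))
      · rw [if_neg hiK, max_eq_right (h i (mem_sdiff.2 ⟨hi, hiK⟩)).le, sub_self, zero_smul]
        exact Submodule.zero_mem _

end SimplicialMultiFan

/-! ### The Duistermaat–Heckman function as a sum of products of half-lines, and its independence of
x. -/

open Classical in
/-- The signed indicator of the half-line `{s | 0 ≤ s}` (sign `-1`) or `{s | s ≤ 0}` (sign `1`),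
according to the sign of `b`. -/
noncomputable def signedHalfLine (b s : ℝ) : ℤ :=
  if 0 < b then (if 0 ≤ s then -1 else 0) else (if s ≤ 0 then 1 else 0)

open Classical in
-- The dependence on `s` (that is, on u) separates from that on `b` (that is, on x). This additive
-- splitting is what makes the expansion over subsets possible.
theorem signedHalfLine_of_ne_zero (b : ℝ) {s : ℝ} (hs : s ≠ 0) :
    signedHalfLine b s = (if s < 0 then 1 else 0) + (if 0 < b then -1 else 0) := by
  unfold signedHalfLine
  rcases lt_or_gt_of_ne hs with h | h
  · simp [h, h.le, not_le.2 h]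
    split_ifs <;> rfl
  · simp [h.le, not_le.2 h, not_lt.2 h.le]

namespace SimpleMultiPolytope

variable {n d : ℕ} (P : SimpleMultiPolytope n d) {I : Finset (Fin d)}

theorem mem_dualCone_iff (hI : I ∈ P.fan.top) (x u : Fin n → ℝ) :
    u ∈ P.dualCone x I ↔ ∀ i ∈ I, if 0 < P.fan.dualVec I i ⬝ᵥ x
      then 0 ≤ u ⬝ᵥ P.fan.vR i - P.c i else u ⬝ᵥ P.fan.vR i - P.c i ≤ 0 := by
  classical
  have hS := P.fan.mem_Sig_of_mem_top hI
  have hv : ∀ i ∈ I, P.vertex I ⬝ᵥ P.fan.vR i = P.c i := fun i hi => P.vertex_mem hS hi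
  have hsum : ∀ r : Fin d → ℝ, ∑ i ∈ I, r i • P.dualVecPlus x I i =
      ∑ i ∈ I, (if 0 < P.fan.dualVec I i ⬝ᵥ x then r i else - r i) • P.fan.dualVec I i := by
    intro r
    refine sum_congr rfl fun i _ => ?_
    unfold dualVecPlus
    split_ifs <;> simp
  constructor
  · rintro ⟨r, hr, rfl⟩ i hi
    rw [add_dotProduct, hv i hi, hsum, P.fan.sum_dualVec_dotProduct hS _ hi]
    split_ifs <;> linarith [hr i]
  · intro h
    -- The sign of each coordinate is dictated by `x`, and `dualVecPlus` carries that sign, so the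
    -- coefficients are the absolute values.
    refine ⟨fun i => |u ⬝ᵥ P.fan.vR i - P.c i|, fun i => abs_nonneg _, ?_⟩
    refine P.fan.eq_of_dotProduct_vR_eq hI fun i hi => ?_
    rw [add_dotProduct, hv i hi, hsum, P.fan.sum_dualVec_dotProduct hS _ hi]
    have := h i hi
    split_ifs at this ⊢
    · rw [abs_of_nonneg this]; ring
    · rw [abs_of_nonpos this]; ring

theorem DH_eq (x u : Fin n → ℝ) :
    P.DH x u = ∑ I ∈ P.fan.top, P.fan.w I *
      ∏ i ∈ I, signedHalfLine (P.fan.dualVec I i ⬝ᵥ x) (u ⬝ᵥ P.fan.vR i - P.c i) := by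
  classical
  unfold DH
  refine sum_congr rfl fun I hI => ?_
  rw [mul_comm _ (P.fan.w I), mul_assoc]
  congr 1
  have h1 : ((-1 : ℤ)) ^ (I.filter (fun i => 0 < P.fan.dualVec I i ⬝ᵥ x)).card =
      ∏ i ∈ I, (if 0 < P.fan.dualVec I i ⬝ᵥ x then -1 else 1) := by
    rw [prod_ite]; simp
  have h2 : (if u ∈ P.dualCone x I then (1 : ℤ) else 0) =
      ∏ i ∈ I, (if (if 0 < P.fan.dualVec I i ⬝ᵥ x
      then 0 ≤ u ⬝ᵥ P.fan.vR i - P.c i else u ⬝ᵥ P.fan.vR i - P.c i ≤ 0) then 1 else 0) := by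
    simp only [prod_ite_zero, prod_const_one, P.mem_dualCone_iff hI]
  rw [h1, h2, ← prod_mul_distrib]
  refine prod_congr rfl fun i _ => ?_
  unfold signedHalfLine
  split_ifs <;> simp

open Classical in
-- In the expansion, K is the set of indices where the u-part of the half-line is chosen. The
-- x-parts over I \ K multiply to a sign times the indicator that C_K(I) contains the image of x.
-- Summing over I ⊇ K gives the degree of Δ_K.
theorem DH_eq_sum_projDeg {x : Fin n → ℝ} (hx : P.fan.IsGeneric x) {u : Fin n → ℝ}
    (hu : ∀ i, u ∉ P.hyperplane i) :
    P.DH x u = ∑ K ∈ P.fan.Sig, (if ∀ i ∈ K, u ⬝ᵥ P.fan.vR i - P.c i < 0 then 1 else 0) *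
      ((-1) ^ (n - K.card) *
        P.fan.projDeg K ((Submodule.span ℝ (P.fan.cone K)).mkQ x)) := by
  have hs : ∀ i, u ⬝ᵥ P.fan.vR i - P.c i ≠ 0 := fun i h => hu i (sub_eq_zero.1 h)
  rw [DH_eq]
  have key : ∀ I ∈ P.fan.top, P.fan.w I *
      ∏ i ∈ I, signedHalfLine (P.fan.dualVec I i ⬝ᵥ x) (u ⬝ᵥ P.fan.vR i - P.c i) =
      ∑ K ∈ P.fan.Sig, if K ⊆ I then
        (if ∀ i ∈ K, u ⬝ᵥ P.fan.vR i - P.c i < 0 then 1 else 0) *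
          ((-1) ^ (n - K.card) *
            (if (Submodule.span ℝ (P.fan.cone K)).mkQ x ∈ P.fan.projCone K I
              then P.fan.w I else 0)) else 0 := by
    intro I hI
    rw [prod_congr rfl fun i _ => signedHalfLine_of_ne_zero _ (hs i), prod_add, mul_sum,
      ← sum_filter]
    -- Every subset of I is a simplex, so the expansion ranges exactly over the faces for which
    -- completeness is available.
    have hpow : P.fan.Sig.filter (fun K => K ⊆ I) = I.powerset := by
      ext K
      simp only [mem_filter, mem_powerset]
      exact ⟨fun h => h.2, fun h =>
        ⟨P.fan.down_closed I (P.fan.mem_Sig_of_mem_top hI) K h, h⟩⟩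
    rw [hpow]
    refine sum_congr rfl fun K hK => ?_
    rw [mem_powerset] at hK
    have hc : (I \ K).card = n - K.card := by
      rw [card_sdiff_of_subset hK, P.fan.card_of_mem_top hI]
    have h3 : ∏ i ∈ I \ K, (if 0 < P.fan.dualVec I i ⬝ᵥ x then (-1 : ℤ) else 0) =
        (-1) ^ (n - K.card) * (if (Submodule.span ℝ (P.fan.cone K)).mkQ x ∈ P.fan.projCone K I
              then 1 else 0) := by
      rw [prod_ite_zero, prod_const, hc]
      simp only [hx.mkQ_mem_projCone_iff hI hK]
      split_ifs <;> simp
    rw [prod_ite_zero, prod_const_one, h3]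
    split_ifs <;> ring
  rw [sum_congr rfl key, sum_comm]
  refine sum_congr rfl fun K _ => ?_
  rw [← sum_filter, ← mul_sum, ← mul_sum, ← sum_filter, filter_filter]
  rfl

/-- Off the hyperplanes `F_i`, the Duistermaat-Heckman function does not depend on `x`. -/
theorem DH_eq_of_isGeneric {x y : Fin n → ℝ} (hx : P.fan.IsGeneric x) (hy : P.fan.IsGeneric y)
    {u : Fin n → ℝ} (hu : ∀ i, u ∉ P.hyperplane i) : P.DH x u = P.DH y u := by
  classical
  rw [P.DH_eq_sum_projDeg hx hu, P.DH_eq_sum_projDeg hy hu]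
  refine sum_congr rfl fun K hK => ?_
  obtain ⟨-, D, hD⟩ := P.complete K hK
  rw [hD _ (hx.isProjGeneric K), hD _ (hy.isProjGeneric K)]

end SimpleMultiPolytope

end

/-! ### Boundedness of the support, integrability and finiteness. -/

section

open Finset MeasureTheory

namespace SimplicialMultiFan

variable {n d : ℕ} (Δ : SimplicialMultiFan n d)

theorem span_cone_ne_top {J : Finset (Fin d)} (hJ : J.card < n) :
    Submodule.span ℝ (Δ.cone J) ≠ ⊤ := by
  classical
  intro h
  have h1 : Module.finrank ℝ (Submodule.span ℝ (Δ.cone J)) ≤ J.card := by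
    rw [span_cone, ← coe_image]
    exact (finrank_span_finset_le_card _).trans card_image_le
  rw [h, finrank_top, Module.finrank_fin_fun] at h1
  omega

/-- Otherwise this span and the spans of the lower-dimensional cones would be finitely many proper
subspaces covering a real vector space. -/
theorem span_isGeneric : Submodule.span ℝ {x | Δ.IsGeneric x} = ⊤ := by
  classical
  by_contra hW
  have hs : (⊤ : Submodule ℝ (Fin n → ℝ)) ∉ insert (Submodule.span ℝ {x | Δ.IsGeneric x})
      ((Δ.Sig.filter fun J => J.card < n).image fun J => Submodule.span ℝ (Δ.cone J)) := by
    simp only [mem_insert, mem_image, mem_filter, not_or, not_exists]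
    exact ⟨fun h => hW h.symm, fun J hJ => Δ.span_cone_ne_top hJ.1.2 hJ.2⟩
  refine Subspace.biUnion_ne_univ_of_top_notMem hs (Set.eq_univ_of_forall fun x => ?_)
  by_cases hx : Δ.IsGeneric x
  · exact Set.mem_biUnion (mem_insert_self _ _) (Submodule.subset_span hx)
  · unfold IsGeneric at hx
    push Not at hx
    obtain ⟨J, hJ, hc, hm⟩ := hx
    exact Set.mem_biUnion (mem_insert_of_mem (mem_image_of_mem _ (mem_filter.2 ⟨hJ, hc⟩))) hm

theorem IsGeneric.neg {Δ : SimplicialMultiFan n d} {x : Fin n → ℝ} (hx : Δ.IsGeneric x) :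
    Δ.IsGeneric (-x) := fun J hJ hc h => hx J hJ hc (by simpa using Submodule.neg_mem _ h)

theorem vR_ne_zero (i : Fin d) : Δ.vR i ≠ 0 := by
  have h := (Δ.linearIndependent {i} (Δ.singleton_mem i)).ne_zero ⟨i, mem_singleton_self i⟩
  exact h

end SimplicialMultiFan

theorem signedHalfLine_ne_zero_imp {b s : ℝ} (h : signedHalfLine b s ≠ 0) : 0 ≤ b * s := by
  unfold signedHalfLine at h
  split_ifs at h with h1 h2 h2
  · positivity
  · exact absurd rfl h
  · exact mul_nonneg_of_nonpos_of_nonpos (not_lt.1 h1) h2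
  · exact absurd rfl h

theorem abs_signedHalfLine_le (b s : ℝ) : |signedHalfLine b s| ≤ 1 := by
  unfold signedHalfLine
  split_ifs <;> simp

theorem measurable_signedHalfLine (b : ℝ) : Measurable (signedHalfLine b) := by
  unfold signedHalfLine
  by_cases h : 0 < b
  · simp only [h, if_true]
    exact Measurable.ite measurableSet_Ici measurable_const measurable_const
  · simp only [h, if_false]
    exact Measurable.ite measurableSet_Iic measurable_const measurable_const

theorem measurable_dotProduct_const {n : ℕ} (v : Fin n → ℝ) :
    Measurable fun u : Fin n → ℝ => u ⬝ᵥ v := by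
  unfold dotProduct
  fun_prop

theorem volume_dotProduct_eq {n : ℕ} {v : Fin n → ℝ} (hv : v ≠ 0) (c : ℝ) :
    volume {u : Fin n → ℝ | u ⬝ᵥ v = c} = 0 := by
  rcases Set.eq_empty_or_nonempty {u : Fin n → ℝ | u ⬝ᵥ v = c} with h | ⟨u₀, hu₀⟩
  · rw [h, measure_empty]
  · let f : (Fin n → ℝ) →ₗ[ℝ] ℝ := (dotProductBilin ℝ ℝ).flip v
    have hf : ∀ u, f u = u ⬝ᵥ v := fun u => rfl
    have h1 : LinearMap.ker f ≠ ⊤ := by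
      intro htop
      have : f v = 0 := by
        rw [← LinearMap.mem_ker, htop]; trivial
      rw [hf] at this
      exact hv (dotProduct_self_eq_zero.1 this)
    have h2 := Measure.addHaar_submodule (volume : Measure (Fin n → ℝ)) _ h1
    rw [← measure_preimage_add_right volume (-u₀)] at h2
    refine measure_mono_null ?_ h2
    intro u hu
    change f (u + -u₀) = 0
    rw [hf, add_dotProduct, neg_dotProduct]
    simp only [Set.mem_ofPred_eq] at hu hu₀
    rw [hu, hu₀]; ring

namespace SimpleMultiPolytope

variable {n d : ℕ} (P : SimpleMultiPolytope n d)

/-- Every dual cone built with `y` opens in the direction of `y`, so on it the pairing with `y` is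
at least its value at the apex. -/
theorem exists_neg_le_dotProduct_of_DH_ne_zero (y : Fin n → ℝ) :
    ∃ C : ℝ, ∀ u, P.DH y u ≠ 0 → -C ≤ u ⬝ᵥ y := by
  refine ⟨∑ I ∈ P.fan.top, |∑ i ∈ I, (P.fan.dualVec I i ⬝ᵥ y) * P.c i|, fun u hu => ?_⟩
  rw [DH_eq] at hu
  obtain ⟨I, hI, hne⟩ := exists_ne_zero_of_sum_ne_zero hu
  have h1 := prod_ne_zero_iff.1 (right_ne_zero_of_mul hne)
  have h2 : ∑ i ∈ I, (P.fan.dualVec I i ⬝ᵥ y) * P.c i ≤ u ⬝ᵥ y := by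
    rw [P.fan.dotProduct_eq_sum hI]
    refine sum_le_sum fun i hi => ?_
    have := signedHalfLine_ne_zero_imp (h1 i hi)
    linarith [mul_sub (P.fan.dualVec I i ⬝ᵥ y) (u ⬝ᵥ P.fan.vR i) (P.c i)]
  have h3 := single_le_sum (f := fun I => |∑ i ∈ I, (P.fan.dualVec I i ⬝ᵥ y) * P.c i|)
    (fun _ _ => abs_nonneg _) hI
  have h4 := neg_abs_le (∑ i ∈ I, (P.fan.dualVec I i ⬝ᵥ y) * P.c i)
  linarith

/-- For generic `y` the function can be computed with `y` or with `-y`, which bounds the pairing on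
both sides. Such bounds pass to linear combinations, and generic vectors span. -/
theorem exists_abs_dotProduct_le {x : Fin n → ℝ} (hx : P.fan.IsGeneric x) (y : Fin n → ℝ) :
    ∃ C : ℝ, ∀ u, (∀ i, u ∉ P.hyperplane i) → P.DH x u ≠ 0 → |u ⬝ᵥ y| ≤ C := by
  have hy : y ∈ Submodule.span ℝ {x | P.fan.IsGeneric x} := by
    rw [P.fan.span_isGeneric]; trivial
  induction hy using Submodule.span_induction with
  | mem z hz =>
    obtain ⟨C, hC⟩ := P.exists_neg_le_dotProduct_of_DH_ne_zero z
    obtain ⟨C', hC'⟩ := P.exists_neg_le_dotProduct_of_DH_ne_zero (-z)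
    refine ⟨max C C', fun u hu h => abs_le.2 ⟨?_, ?_⟩⟩
    · have := hC u (by rwa [P.DH_eq_of_isGeneric hz hx hu])
      linarith [le_max_left C C']
    · have := hC' u (by
        rwa [P.DH_eq_of_isGeneric (SimplicialMultiFan.IsGeneric.neg hz) hx hu])
      rw [dotProduct_neg] at this
      linarith [le_max_right C C']
  | zero => exact ⟨0, fun u _ _ => by simp⟩
  | add a b _ _ ha hb =>
    obtain ⟨A, hA⟩ := ha
    obtain ⟨B, hB⟩ := hb
    refine ⟨A + B, fun u hu h => ?_⟩
    rw [dotProduct_add]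
    exact (abs_add_le _ _).trans (add_le_add (hA u hu h) (hB u hu h))
  | smul c a _ ha =>
    obtain ⟨A, hA⟩ := ha
    refine ⟨|c| * A, fun u hu h => ?_⟩
    rw [dotProduct_smul, smul_eq_mul, abs_mul]
    exact mul_le_mul_of_nonneg_left (hA u hu h) (abs_nonneg _)

theorem exists_norm_le {x : Fin n → ℝ} (hx : P.fan.IsGeneric x) :
    ∃ C : ℝ, ∀ u, (∀ i, u ∉ P.hyperplane i) → P.DH x u ≠ 0 → ‖u‖ ≤ C := by
  choose C hC using fun k : Fin n => P.exists_abs_dotProduct_le hx (Pi.single k 1)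
  refine ⟨∑ k, |C k|, fun u hu h => ?_⟩
  refine (pi_norm_le_iff_of_nonneg (sum_nonneg fun _ _ => abs_nonneg _)).2 fun k => ?_
  have h1 := hC k u hu h
  rw [dotProduct_single, mul_one] at h1
  rw [Real.norm_eq_abs]
  exact (h1.trans (le_abs_self _)).trans
    (single_le_sum (f := fun k => |C k|) (fun _ _ => abs_nonneg _) (mem_univ k))

theorem measurable_DH (x : Fin n → ℝ) : Measurable (P.DH x) := by
  have h : P.DH x = fun u => ∑ I ∈ P.fan.top, P.fan.w I *
      ∏ i ∈ I, signedHalfLine (P.fan.dualVec I i ⬝ᵥ x) (u ⬝ᵥ P.fan.vR i - P.c i) :=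
    funext fun u => P.DH_eq x u
  rw [h]
  refine Finset.measurable_fun_sum _ fun I _ => Measurable.const_mul ?_ _
  refine Finset.measurable_fun_prod _ fun i _ => (measurable_signedHalfLine _).comp ?_
  exact (measurable_dotProduct_const _).sub_const _

theorem abs_DH_le (x u : Fin n → ℝ) : |P.DH x u| ≤ ∑ I ∈ P.fan.top, |P.fan.w I| := by
  rw [DH_eq]
  refine (abs_sum_le_sum_abs _ _).trans (sum_le_sum fun I _ => ?_)
  rw [abs_mul, abs_prod]
  exact mul_le_of_le_one_right (abs_nonneg _)
    (prod_le_one (fun _ _ => abs_nonneg _) fun _ _ => abs_signedHalfLine_le _ _)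

theorem ae_notMem_hyperplane : ∀ᵐ u : Fin n → ℝ, ∀ i, u ∉ P.hyperplane i := by
  rw [ae_all_iff]
  intro i
  rw [ae_iff]
  simp only [not_not]
  exact volume_dotProduct_eq (P.fan.vR_ne_zero i) _

theorem integrable_DH {x : Fin n → ℝ} (hx : P.fan.IsGeneric x) :
    Integrable fun u : Fin n → ℝ => (P.DH x u : ℝ) := by
  obtain ⟨C, hC⟩ := P.exists_norm_le hx
  have hm : Measurable fun u : Fin n → ℝ => (P.DH x u : ℝ) :=
    (measurable_of_countable _).comp (P.measurable_DH x)
  have h1 : IntegrableOn (fun u : Fin n → ℝ => (P.DH x u : ℝ)) (Metric.closedBall 0 C) := by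
    refine Measure.integrableOn_of_bounded (M := ((∑ I ∈ P.fan.top, |P.fan.w I| : ℤ) : ℝ))
      (isCompact_closedBall _ _).measure_lt_top.ne hm.aestronglyMeasurable ?_
    refine Filter.Eventually.of_forall fun u => ?_
    rw [Real.norm_eq_abs]
    exact_mod_cast P.abs_DH_le x u
  refine (h1.integrable_indicator measurableSet_closedBall).congr ?_
  filter_upwards [P.ae_notMem_hyperplane] with u hu
  by_cases hz : P.DH x u = 0
  · simp [Set.indicator, hz]
  · rw [Set.indicator_of_mem]
    simpa using hC u hu hz

theorem vol_eq_of_isGeneric {x y : Fin n → ℝ} (hx : P.fan.IsGeneric x) (hy : P.fan.IsGeneric y) :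
    P.vol x = P.vol y := by
  refine integral_congr_ae ?_
  filter_upwards [P.ae_notMem_hyperplane] with u hu
  rw [P.DH_eq_of_isGeneric hx hy hu]

open Filter Topology in
-- Dominated convergence: ⟨u, x⟩ is bounded by some `C` almost everywhere on the support, so for |t|
-- ≤ 1 the exponential is at most e^C there.
theorem tendsto_integral_DH_mul_exp {x : Fin n → ℝ} (hx : P.fan.IsGeneric x) :
    Tendsto (fun t : ℝ => ∫ u : Fin n → ℝ, (P.DH x u : ℝ) * Real.exp (t * (u ⬝ᵥ x)))
      (𝓝[<] 0) (𝓝 (P.vol x)) := by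
  obtain ⟨C, hC⟩ := P.exists_abs_dotProduct_le hx x
  have hm : Measurable fun u : Fin n → ℝ => (P.DH x u : ℝ) :=
    (measurable_of_countable _).comp (P.measurable_DH x)
  refine tendsto_integral_filter_of_dominated_convergence
    (fun u => ‖(P.DH x u : ℝ)‖ * Real.exp C) ?_ ?_ ((P.integrable_DH hx).norm.mul_const _) ?_
  · refine Eventually.of_forall fun t => Measurable.aestronglyMeasurable ?_
    exact hm.mul (((measurable_dotProduct_const x).const_mul t).exp)
  · have h1 : ∀ᶠ t : ℝ in 𝓝[<] 0, |t| ≤ 1 := by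
      refine nhdsWithin_le_nhds ?_
      filter_upwards [Metric.closedBall_mem_nhds (0 : ℝ) one_pos] with t ht
      simpa using ht
    filter_upwards [h1] with t ht
    filter_upwards [P.ae_notMem_hyperplane] with u hu
    rw [norm_mul]
    by_cases hz : P.DH x u = 0
    · simp [hz]
    refine mul_le_mul_of_nonneg_left ?_ (norm_nonneg _)
    rw [Real.norm_eq_abs, Real.abs_exp]
    refine Real.exp_le_exp.2 ?_
    have h2 := hC u hu hz
    calc t * (u ⬝ᵥ x) ≤ |t * (u ⬝ᵥ x)| := le_abs_self _
      _ = |t| * |u ⬝ᵥ x| := abs_mul _ _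
      _ ≤ 1 * |u ⬝ᵥ x| := mul_le_mul_of_nonneg_right ht (abs_nonneg _)
      _ ≤ C := by rwa [one_mul]
  · refine Eventually.of_forall fun u => ?_
    have h3 : Continuous fun t : ℝ => (P.DH x u : ℝ) * Real.exp (t * (u ⬝ᵥ x)) := by fun_prop
    have h4 := h3.tendsto 0
    simp only [zero_mul, Real.exp_zero, mul_one] at h4
    exact h4.mono_left nhdsWithin_le_nhds

/-- The `c_i` of a lattice multi-polytope are integers. -/
theorem IsLattice.exists_int {P : SimpleMultiPolytope n d} (hP : P.IsLattice) (i : Fin d) :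
    ∃ m : ℤ, P.c i = m := by
  obtain ⟨⟨J, hJ, hiJ⟩, -⟩ := P.complete {i} (P.fan.singleton_mem i)
  obtain ⟨u, hu⟩ := hP J hJ
  have h := P.vertex_mem (P.fan.mem_Sig_of_mem_top hJ) (singleton_subset_iff.1 hiJ)
  rw [hu] at h
  refine ⟨u ⬝ᵥ P.fan.v i, ?_⟩
  rw [← (show _ = P.c i from h)]
  simp [dotProduct, SimplicialMultiFan.vR]

/-- Lattice points pair integrally with v_i and c_i is an integer, so the value c_i + ε_i is never
attained. -/
theorem IsLattice.notMem_hyperplane_shift {P : SimpleMultiPolytope n d} (hP : P.IsLattice)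
    {ε : Fin d → ℝ} (hε : ∀ i, 0 < ε i ∧ ε i < 1) (u : Fin n → ℤ) (i : Fin d) :
    (fun k => (u k : ℝ)) ∉ (P.shift ε).hyperplane i := by
  intro h
  obtain ⟨m, hm⟩ := hP.exists_int i
  have h1 : ((u ⬝ᵥ P.fan.v i - m : ℤ) : ℝ) = ε i := by
    have h2 : (fun k => (u k : ℝ)) ⬝ᵥ P.fan.vR i = P.c i + ε i := h
    have h3 : (fun k => (u k : ℝ)) ⬝ᵥ P.fan.vR i = ((u ⬝ᵥ P.fan.v i : ℤ) : ℝ) := by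
      simp [dotProduct, SimplicialMultiFan.vR]
    push_cast
    rw [← h3, h2, hm]; ring
  have h4 := hε i
  rw [← h1] at h4
  have h5 : (0 : ℤ) < u ⬝ᵥ P.fan.v i - m := by exact_mod_cast h4.1
  have h6 : u ⬝ᵥ P.fan.v i - m < 1 := by exact_mod_cast h4.2
  omega

theorem IsLattice.finite_support_latticeDH {P : SimpleMultiPolytope n d} (hP : P.IsLattice)
    {x : Fin n → ℝ} (hx : P.fan.IsGeneric x)
    {ε : Fin d → ℝ} (hε : ∀ i, 0 < ε i ∧ ε i < 1) :
    (Function.support ((P.shift ε).latticeDH x)).Finite := by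
  obtain ⟨C, hC⟩ := (P.shift ε).exists_norm_le (x := x) hx
  refine (isCompact_closedBall (0 : Fin n → ℤ) C).finite_of_discrete |>.subset ?_
  intro u hu
  have h := hC (fun k => (u k : ℝ)) (hP.notMem_hyperplane_shift hε u) hu
  rw [mem_closedBall_zero_iff]
  have hC0 : 0 ≤ C := (norm_nonneg _).trans h
  refine (pi_norm_le_iff_of_nonneg hC0).2 fun k => ?_
  have := (pi_norm_le_iff_of_nonneg hC0).1 h k
  rw [Int.norm_eq_abs]
  rwa [Real.norm_eq_abs] at this

end SimpleMultiPolytope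

end

/-! ### Asymptotic expansions for t → 0⁻. -/

section

open Filter Topology Asymptotics

/-- `f` has the power series `φ` as asymptotic expansion for `t → 0⁻`. -/
def HasAsymp (f : ℝ → ℂ) (φ : PowerSeries ℂ) : Prop :=
  ∀ N : ℕ, ∃ p : Polynomial ℂ, (fun t : ℝ => f t - p.eval (t : ℂ)) =O[𝓝[<] 0] (fun t => t ^ N) ∧
    PowerSeries.X ^ N ∣ φ - (p : PowerSeries ℂ)

theorem isBigO_ofReal_left {f : ℝ → ℂ} {N : ℕ} :
    f =O[𝓝[<] 0] (fun t : ℝ => t ^ N) ↔ f =O[𝓝[<] 0] (fun t : ℝ => (t : ℂ) ^ N) := by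
  refine (isBigO_norm_right).symm.trans (Iff.trans ?_ isBigO_norm_right)
  simp

theorem isBigO_one_of_continuous {f : ℝ → ℂ} (hf : Continuous f) :
    f =O[𝓝[<] 0] (fun _ => (1 : ℝ)) :=
  ((hf.tendsto 0).mono_left nhdsWithin_le_nhds).isBigO_one ℝ

theorem Polynomial.isBigO_one_eval (p : Polynomial ℂ) :
    (fun t : ℝ => p.eval (t : ℂ)) =O[𝓝[<] 0] (fun _ => (1 : ℝ)) :=
  isBigO_one_of_continuous (p.continuous.comp Complex.continuous_ofReal)

theorem Polynomial.isBigO_eval_of_X_pow_dvd {p : Polynomial ℂ} {N : ℕ}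
    (h : (PowerSeries.X : PowerSeries ℂ) ^ N ∣ (p : PowerSeries ℂ)) :
    (fun t : ℝ => p.eval (t : ℂ)) =O[𝓝[<] 0] (fun t => t ^ N) := by
  have h1 : (Polynomial.X : Polynomial ℂ) ^ N ∣ p := by
    rw [Polynomial.X_pow_dvd_iff]
    intro d hd
    have := PowerSeries.X_pow_dvd_iff.1 h d hd
    rwa [Polynomial.coeff_coe] at this
  obtain ⟨q, rfl⟩ := h1
  rw [isBigO_ofReal_left]
  simp only [Polynomial.eval_mul, Polynomial.eval_pow, Polynomial.eval_X]
  rw [← isBigO_ofReal_left]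
  simpa using ((isBigO_ofReal_left (f := fun t : ℝ => (t : ℂ) ^ N)).2
    (isBigO_refl _ _)).mul q.isBigO_one_eval

theorem isBigO_pow_of_le {M N : ℕ} (h : M ≤ N) :
    (fun t : ℝ => t ^ N) =O[𝓝[<] 0] (fun t : ℝ => t ^ M) := by
  refine IsBigO.of_bound 1 (nhdsWithin_le_nhds ?_)
  filter_upwards [Metric.closedBall_mem_nhds (0 : ℝ) one_pos] with t ht
  rw [norm_pow, norm_pow, one_mul]
  exact pow_le_pow_of_le_one (norm_nonneg _) (by simpa using ht) h

namespace HasAsymp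

variable {f g : ℝ → ℂ} {φ ψ : PowerSeries ℂ}

theorem of_polynomial (p : Polynomial ℂ) : HasAsymp (fun t : ℝ => p.eval (t : ℂ)) p :=
  fun N => ⟨p, by simpa using isBigO_zero _ _, by simp⟩

theorem const (c : ℂ) : HasAsymp (fun _ => c) (PowerSeries.C c) := by
  simpa using of_polynomial (Polynomial.C c)

theorem const_mul_pow (c : ℂ) (r : ℕ) :
    HasAsymp (fun t : ℝ => c * (t : ℂ) ^ r) (PowerSeries.C c * PowerSeries.X ^ r) := by
  have h := of_polynomial (Polynomial.C c * Polynomial.X ^ r)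
  rw [Polynomial.coe_mul, Polynomial.coe_pow, Polynomial.coe_C, Polynomial.coe_X] at h
  simpa only [Polynomial.eval_mul, Polynomial.eval_pow, Polynomial.eval_X,
    Polynomial.eval_C] using h

theorem congr (hf : HasAsymp f φ) (h : f =ᶠ[𝓝[<] 0] g) : HasAsymp g φ := by
  intro N
  obtain ⟨p, hp, hd⟩ := hf N
  exact ⟨p, hp.congr' (h.mono fun t ht => by simp [ht]) EventuallyEq.rfl, hd⟩

theorem isBigO_one (hf : HasAsymp f φ) : f =O[𝓝[<] 0] (fun _ => (1 : ℝ)) := by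
  obtain ⟨p, hp, -⟩ := hf 0
  simpa using (hp.trans (by simpa using isBigO_refl (fun _ : ℝ => (1 : ℝ)) _)).add p.isBigO_one_eval

theorem isBigO_pow (hf : HasAsymp f φ) {N : ℕ} (h : PowerSeries.X ^ N ∣ φ) :
    f =O[𝓝[<] 0] (fun t : ℝ => t ^ N) := by
  obtain ⟨p, hp, hd⟩ := hf N
  have h1 : (PowerSeries.X : PowerSeries ℂ) ^ N ∣ p := by
    simpa using dvd_sub h hd
  simpa using hp.add (Polynomial.isBigO_eval_of_X_pow_dvd h1)

theorem add (hf : HasAsymp f φ) (hg : HasAsymp g ψ) : HasAsymp (fun t => f t + g t) (φ + ψ) := by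
  intro N
  obtain ⟨p, hp, hd⟩ := hf N
  obtain ⟨q, hq, he⟩ := hg N
  refine ⟨p + q, ?_, ?_⟩
  · simpa [add_sub_add_comm] using hp.add hq
  · simpa [add_sub_add_comm] using dvd_add hd he

theorem mul (hf : HasAsymp f φ) (hg : HasAsymp g ψ) : HasAsymp (fun t => f t * g t) (φ * ψ) := by
  intro N
  obtain ⟨p, hp, hd⟩ := hf N
  obtain ⟨q, hq, he⟩ := hg N
  refine ⟨p * q, ?_, ?_⟩
  · have h1 := hp.mul hg.isBigO_one
    have h2 := p.isBigO_one_eval.mul hq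
    simp only [mul_one, one_mul] at h1 h2
    refine (h1.add h2).congr_left fun t => ?_
    rw [Polynomial.eval_mul]; ring
  · have h3 : φ * ψ - ((p * q : Polynomial ℂ) : PowerSeries ℂ) =
        (φ - p) * ψ + p * (ψ - q) := by
      rw [Polynomial.coe_mul]; ring
    rw [h3]
    exact dvd_add (Dvd.dvd.mul_right hd _) (Dvd.dvd.mul_left he _)

theorem neg (hf : HasAsymp f φ) : HasAsymp (fun t => - f t) (-φ) := by
  simpa using (const (-1)).mul hf

theorem sub (hf : HasAsymp f φ) (hg : HasAsymp g ψ) : HasAsymp (fun t => f t - g t) (φ - ψ) := by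
  simpa [sub_eq_add_neg] using hf.add hg.neg

theorem sum {ι : Type*} {s : Finset ι} {f : ι → ℝ → ℂ} {φ : ι → PowerSeries ℂ}
    (h : ∀ i ∈ s, HasAsymp (f i) (φ i)) : HasAsymp (fun t => ∑ i ∈ s, f i t) (∑ i ∈ s, φ i) := by
  classical
  induction s using Finset.induction_on with
  | empty => simpa using const 0
  | insert a s ha ih =>
    simp only [Finset.sum_insert ha]
    exact (h a (Finset.mem_insert_self a s)).add
      (ih fun i hi => h i (Finset.mem_insert_of_mem hi))

theorem prod {ι : Type*} {s : Finset ι} {f : ι → ℝ → ℂ} {φ : ι → PowerSeries ℂ}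
    (h : ∀ i ∈ s, HasAsymp (f i) (φ i)) : HasAsymp (fun t => ∏ i ∈ s, f i t) (∏ i ∈ s, φ i) := by
  classical
  induction s using Finset.induction_on with
  | empty => simpa using const 1
  | insert a s ha ih =>
    simp only [Finset.prod_insert ha]
    exact (h a (Finset.mem_insert_self a s)).mul
      (ih fun i hi => h i (Finset.mem_insert_of_mem hi))

theorem X_pow_dvd_sub_trunc (φ : PowerSeries ℂ) (N : ℕ) :
    PowerSeries.X ^ N ∣ φ - (PowerSeries.trunc N φ : PowerSeries ℂ) := by
  rw [PowerSeries.X_pow_dvd_iff]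
  intro m hm
  simp [PowerSeries.coeff_trunc, hm]

theorem exp (b : ℂ) : HasAsymp (fun t : ℝ => Complex.exp (b * t))
    (PowerSeries.rescale b (PowerSeries.exp ℂ)) := by
  intro N
  -- One term more than needed, because `Complex.exp_bound` requires a positive number of terms.
  refine ⟨PowerSeries.trunc (N + 1) (PowerSeries.rescale b (PowerSeries.exp ℂ)), ?_,
    (pow_dvd_pow _ (Nat.le_succ N)).trans (X_pow_dvd_sub_trunc _ _)⟩
  have h1 : ∀ᶠ t : ℝ in 𝓝[<] 0, ‖b * (t : ℂ)‖ ≤ 1 := by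
    refine nhdsWithin_le_nhds ?_
    have hc : Continuous fun t : ℝ => ‖b * (t : ℂ)‖ := by fun_prop
    have := hc.tendsto 0
    simp only [Complex.ofReal_zero, mul_zero, norm_zero] at this
    exact this.eventually (ge_mem_nhds one_pos)
  refine IsBigO.trans (g := fun t : ℝ => t ^ (N + 1)) ?_ (isBigO_pow_of_le (Nat.le_succ N))
  refine IsBigO.of_bound
    (‖b‖ ^ (N + 1) * (((N + 1).succ : ℝ) * ((N + 1).factorial * (N + 1 : ℕ) : ℝ)⁻¹)) ?_
  filter_upwards [h1] with t ht
  have h2 := Complex.exp_bound ht (Nat.succ_pos N)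
  have h3 : (PowerSeries.trunc (N + 1) (PowerSeries.rescale b (PowerSeries.exp ℂ))).eval (t : ℂ) =
      ∑ m ∈ Finset.range (N + 1), (b * (t : ℂ)) ^ m / m.factorial := by
    rw [Polynomial.eval, PowerSeries.eval₂_trunc_eq_sum_range]
    refine Finset.sum_congr rfl fun m _ => ?_
    rw [RingHom.id_apply, PowerSeries.coeff_rescale, PowerSeries.coeff_exp, mul_pow]
    simp
    ring
  rw [h3]
  refine h2.trans (le_of_eq ?_)
  rw [norm_mul, mul_pow, Complex.norm_real, norm_pow, Nat.succ_eq_add_one]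
  ring

/-- Cancellation: if `f g ~ φ γ` and `g ~ γ ≠ 0`, then `f ~ φ`. -/
theorem of_mul {γ : PowerSeries ℂ} (hfg : HasAsymp (fun t => f t * g t) (φ * γ))
    (hg : HasAsymp g γ) (hγ : γ ≠ 0) : HasAsymp f φ := by
  intro N
  set p := PowerSeries.trunc N φ with hp
  refine ⟨p, ?_, X_pow_dvd_sub_trunc φ N⟩
  -- c X^r is the leading term of `γ`. Dividing by `g` costs exactly r orders, so the product is
  -- expanded to order N + r.
  obtain ⟨r, c, hc, hr⟩ : ∃ (r : ℕ) (c : ℂ), c ≠ 0 ∧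
      PowerSeries.X ^ (r + 1) ∣ γ - PowerSeries.C c * PowerSeries.X ^ r := by
    classical
    have hex : ∃ k, PowerSeries.coeff k γ ≠ 0 := by
      by_contra! h
      exact hγ (PowerSeries.ext fun k => by simpa using h k)
    refine ⟨Nat.find hex, PowerSeries.coeff (Nat.find hex) γ, Nat.find_spec hex, ?_⟩
    rw [PowerSeries.X_pow_dvd_iff]
    intro m hm
    rw [map_sub, PowerSeries.coeff_C_mul, PowerSeries.coeff_X_pow]
    rcases Nat.lt_succ_iff_lt_or_eq.1 hm with h | h
    · simp [h.ne, not_not.1 (Nat.find_min hex h)]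
    · simp [← h]
  have hX : HasAsymp (fun t : ℝ => c * (t : ℂ) ^ r) (PowerSeries.C c * PowerSeries.X ^ r) := const_mul_pow _ _
  have h1 := (hg.sub hX).isBigO_pow hr
  have h2 : (fun t : ℝ => t ^ r) =O[𝓝[<] 0] g := by
    have h3 : (fun t : ℝ => t ^ (r + 1)) =o[𝓝[<] 0] (fun t : ℝ => c * (t : ℂ) ^ r) := by
      rw [← isLittleO_norm_right]
      simp only [norm_mul, norm_pow, Complex.norm_real]
      rw [isLittleO_const_mul_right_iff (norm_ne_zero_iff.2 hc)]
      simp only [← norm_pow]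
      rw [isLittleO_norm_right]
      exact (isLittleO_pow_pow (Nat.lt_succ_self r)).mono nhdsWithin_le_nhds
    have h4 := (h1.trans_isLittleO h3).right_isBigO_add
    simp only [sub_add_cancel] at h4
    refine IsBigO.trans ?_ h4
    rw [← isBigO_norm_right]
    simp only [norm_mul, norm_pow, Complex.norm_real]
    rw [isBigO_const_mul_right_iff (norm_ne_zero_iff.2 hc)]
    simp only [← norm_pow]
    exact (isBigO_norm_right).2 (isBigO_refl _ _)
  have h5 : (fun t => (f t - p.eval (t : ℂ)) * g t) =O[𝓝[<] 0] (fun t : ℝ => t ^ (N + r)) := by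
    have h6 := hfg.sub ((of_polynomial p).mul hg)
    have h7 := h6.isBigO_pow (N := N + r) (by
      rw [← sub_mul, pow_add]
      refine mul_dvd_mul (X_pow_dvd_sub_trunc φ N) ?_
      have h8 := dvd_add ((pow_dvd_pow _ (Nat.le_succ r)).trans hr)
        (Dvd.intro_left (PowerSeries.C c) rfl : PowerSeries.X ^ r ∣ _)
      simpa using h8)
    refine h7.congr_left fun t => by ring
  have h9 : (fun t => (f t - p.eval (t : ℂ)) * ((t : ℂ) ^ r)) =O[𝓝[<] 0]
      (fun t : ℝ => t ^ (N + r)) := by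
    refine IsBigO.trans (IsBigO.mul (isBigO_refl _ _) ?_) h5
    rw [← isBigO_norm_left] at h2 ⊢
    simpa using h2
  obtain ⟨K, hK⟩ := h9.bound
  refine IsBigO.of_bound K ?_
  filter_upwards [hK, self_mem_nhdsWithin] with t ht ht0
  have ht1 : 0 < ‖t‖ ^ r := pow_pos (norm_pos_iff.2 (ne_of_lt ht0)) r
  rw [norm_mul, norm_pow, norm_pow, Complex.norm_real, pow_add, ← mul_assoc] at ht
  rw [norm_pow]
  exact le_of_mul_le_mul_right ht ht1

/-- By strong induction: once the lower coefficients vanish, f differs from its k-th term by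
O(t^{k+1}). That term is then o(t^k), which forces its coefficient to be zero. -/
theorem coeff_eq_zero_of_isLittleO (hf : HasAsymp f φ) {n : ℕ}
    (h : f =o[𝓝[<] 0] (fun t : ℝ => t ^ n)) : ∀ k ≤ n, PowerSeries.coeff k φ = 0 := by
  intro k
  induction k using Nat.strong_induction_on with
  | _ k ih =>
    intro hk
    by_contra hc
    have hd : PowerSeries.X ^ (k + 1) ∣ φ - PowerSeries.C (PowerSeries.coeff k φ) *
        PowerSeries.X ^ k := by
      rw [PowerSeries.X_pow_dvd_iff]
      intro m hm
      rw [map_sub, PowerSeries.coeff_C_mul, PowerSeries.coeff_X_pow]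
      rcases Nat.lt_succ_iff_lt_or_eq.1 hm with h' | h'
      · simp [h'.ne, ih m h' (h'.le.trans hk)]
      · simp [← h']
    have hX : HasAsymp (fun t : ℝ => PowerSeries.coeff k φ * (t : ℂ) ^ k)
        (PowerSeries.C (PowerSeries.coeff k φ) * PowerSeries.X ^ k) := const_mul_pow _ _
    have h1 : (fun t : ℝ => f t - PowerSeries.coeff k φ * (t : ℂ) ^ k) =o[𝓝[<] 0]
        (fun t : ℝ => t ^ k) :=
      ((hf.sub hX).isBigO_pow hd).trans_isLittleO
        ((isLittleO_pow_pow (Nat.lt_succ_self k)).mono nhdsWithin_le_nhds)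
    have h2 := (h.trans_isBigO (isBigO_pow_of_le hk)).sub h1
    simp only [sub_sub_cancel] at h2
    rw [isLittleO_const_mul_left_iff hc] at h2
    have h3 : (fun t : ℝ => t ^ k) =o[𝓝[<] 0] (fun t : ℝ => t ^ k) := by
      rw [← isLittleO_norm_left] at h2 ⊢
      simpa using h2
    have h4 := isLittleO_irrefl' (f' := fun t : ℝ => t ^ k) (l := 𝓝[<] 0) (by
      refine Eventually.frequently ?_
      filter_upwards [self_mem_nhdsWithin] with t ht
      simpa using fun h0 => absurd h0 (ne_of_lt ht))
    exact h4 h3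

/-- If `F ~ φ` and `F t / t ^ n → ℓ`, then `ℓ` is the coefficient of `X ^ n` in `φ`. -/
theorem eq_coeff_of_tendsto {F E : ℝ → ℂ} {n : ℕ} {ℓ : ℂ} (hF : HasAsymp F φ)
    (hE : ∀ᶠ t : ℝ in 𝓝[<] 0, (t : ℂ) ^ n * E t = F t) (hℓ : Tendsto E (𝓝[<] 0) (𝓝 ℓ)) :
    ℓ = PowerSeries.coeff n φ := by
  have hX : HasAsymp (fun t : ℝ => ℓ * (t : ℂ) ^ n) (PowerSeries.C ℓ * PowerSeries.X ^ n) := const_mul_pow _ _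
  have h1 : (fun t => F t - ℓ * (t : ℂ) ^ n) =o[𝓝[<] 0] (fun t : ℝ => t ^ n) := by
    have h2 : (fun t => E t - ℓ) =o[𝓝[<] 0] (fun _ => (1 : ℝ)) := by
      rw [isLittleO_one_iff]
      simpa using hℓ.sub_const ℓ
    have h3 := ((isBigO_ofReal_left (f := fun t : ℝ => (t : ℂ) ^ n)).2
      (isBigO_refl _ _)).mul_isLittleO h2
    simp only [mul_one] at h3
    refine h3.congr' ?_ EventuallyEq.rfl
    filter_upwards [hE] with t ht
    rw [← ht]; ring
  have h4 := (hF.sub hX).coeff_eq_zero_of_isLittleO h1 n le_rfl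
  rw [map_sub, PowerSeries.coeff_C_mul, PowerSeries.coeff_X_pow_self, mul_one] at h4
  exact (sub_eq_zero.1 h4).symm

end HasAsymp

end

/-! ### Exponential integrals over the vertex cones. -/

section

open Finset MeasureTheory

/-- The half-line points in the direction where the exponential decays, and its sign is chosen so
that both directions give the same closed formula. -/
theorem signedHalfLine_mul_exp_integral {b t : ℝ} (hb : b ≠ 0) (ht : t < 0) (c : ℝ) :
    Integrable (fun s : ℝ => (signedHalfLine b (s - c) : ℝ) * Real.exp (t * (b * s))) ∧
    ∫ s : ℝ, (signedHalfLine b (s - c) : ℝ) * Real.exp (t * (b * s)) =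
      Real.exp (t * (b * c)) / (t * b) := by
  rcases lt_or_gt_of_ne hb with h | h
  · have hf : (fun s : ℝ => (signedHalfLine b (s - c) : ℝ) * Real.exp (t * (b * s))) =
        (Set.Iic c).indicator fun s => Real.exp (t * b * s) := by
      ext s
      by_cases hs : s ≤ c <;> simp [signedHalfLine, not_lt.2 h.le, Set.indicator, hs, mul_assoc]
    have hpos : 0 < t * b := mul_pos_of_neg_of_neg ht h
    rw [hf]
    constructor
    · exact (integrableOn_exp_mul_Iic hpos c).integrable_indicator measurableSet_Iic
    · rw [integral_indicator measurableSet_Iic, integral_exp_mul_Iic hpos, mul_assoc]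
  · have hf : (fun s : ℝ => (signedHalfLine b (s - c) : ℝ) * Real.exp (t * (b * s))) =
        (Set.Ici c).indicator fun s => -Real.exp (t * b * s) := by
      ext s
      by_cases hs : c ≤ s <;> simp [signedHalfLine, h, Set.indicator, hs, mul_assoc]
    have hneg : t * b < 0 := mul_neg_of_neg_of_pos ht h
    rw [hf]
    constructor
    · refine IntegrableOn.integrable_indicator ?_ measurableSet_Ici
      rw [integrableOn_Ici_iff_integrableOn_Ioi]
      exact (integrableOn_exp_mul_Ioi hneg c).neg
    · rw [integral_indicator measurableSet_Ici, integral_Ici_eq_integral_Ioi, integral_neg,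
        integral_exp_mul_Ioi hneg, mul_assoc, neg_div, neg_neg]

theorem integral_prod_mulVec {n : ℕ} {M : Matrix (Fin n) (Fin n) ℝ} (hM : M.det ≠ 0)
    {φ : Fin n → ℝ → ℝ} (hφ : ∀ j, Integrable (φ j)) :
    Integrable (fun u : Fin n → ℝ => ∏ j, φ j ((M *ᵥ u) j)) ∧
    ∫ u : Fin n → ℝ, ∏ j, φ j ((M *ᵥ u) j) = |M.det|⁻¹ * ∏ j, ∫ s, φ j s := by
  have hmap := Real.map_matrix_volume_pi_eq_smul_volume_pi hM
  have hF : Integrable fun s : Fin n → ℝ => ∏ j, φ j (s j) := Integrable.fintype_prod hφ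
  have hF' : Integrable (fun s : Fin n → ℝ => ∏ j, φ j (s j))
      (Measure.map (Matrix.toLin' M) volume) := by
    rw [hmap]
    exact hF.smul_measure ENNReal.ofReal_ne_top
  have hm : Measurable (Matrix.toLin' M) :=
    (LinearMap.continuous_of_finiteDimensional _).measurable
  constructor
  · exact hF'.comp_measurable hm
  · have h1 := integral_map hm.aemeasurable hF'.aestronglyMeasurable
    rw [hmap, integral_smul_measure, integral_fintype_prod_volume_eq_prod,
      ENNReal.toReal_ofReal (abs_nonneg _), abs_inv, smul_eq_mul] at h1
    rw [h1]
    rfl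

namespace SimplicialMultiFan

variable {n d : ℕ} (Δ : SimplicialMultiFan n d) {I : Finset (Fin d)}

/-- An enumeration of the labels of the rays of a cone of dimension `n`. -/
noncomputable def enum (hI : I ∈ Δ.top) : Fin n ≃ {i // i ∈ I} :=
  (I.equivFinOfCardEq (Δ.card_of_mem_top hI)).symm

/-- The matrix with rows `v_i`, `i ∈ I`. -/
noncomputable def coneMatrix (hI : I ∈ Δ.top) : Matrix (Fin n) (Fin n) ℤ :=
  Matrix.of fun j => Δ.v (Δ.enum hI j)

theorem prod_enum {M : Type*} [CommMonoid M] (hI : I ∈ Δ.top) (f : Fin d → M) :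
    ∏ j, f (Δ.enum hI j) = ∏ i ∈ I, f i := by
  rw [← Finset.prod_coe_sort I f, ← (Δ.enum hI).prod_comp]

theorem sum_enum {M : Type*} [AddCommMonoid M] (hI : I ∈ Δ.top) (f : Fin d → M) :
    ∑ j, f (Δ.enum hI j) = ∑ i ∈ I, f i := by
  rw [← Finset.sum_coe_sort I f, ← (Δ.enum hI).sum_comp]

theorem coneMatrix_map_mulVec (hI : I ∈ Δ.top) (u : Fin n → ℝ) (j : Fin n) :
    ((Δ.coneMatrix hI).map (Int.cast : ℤ → ℝ) *ᵥ u) j = u ⬝ᵥ Δ.vR (Δ.enum hI j) := by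
  rw [Matrix.mulVec, dotProduct_comm]
  rfl

theorem det_coneMatrix_map (hI : I ∈ Δ.top) :
    ((Δ.coneMatrix hI).map (Int.cast : ℤ → ℝ)).det = ((Δ.coneMatrix hI).det : ℝ) :=
  ((Int.castRingHom ℝ).map_det _).symm

theorem det_coneMatrix_ne_zero (hI : I ∈ Δ.top) : (Δ.coneMatrix hI).det ≠ 0 := by
  have h1 : LinearIndependent ℝ ((Δ.coneMatrix hI).map (Int.cast : ℤ → ℝ)).row := by
    have h := Δ.linearIndependent I (Δ.mem_Sig_of_mem_top hI)
    exact h.comp (Δ.enum hI) (Δ.enum hI).injective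
  have h2 := Matrix.linearIndependent_rows_iff_isUnit.1 h1
  rw [Matrix.isUnit_iff_isUnit_det, isUnit_iff_ne_zero, det_coneMatrix_map] at h2
  exact_mod_cast h2

/-- In the coordinates ⟨u, v_i⟩ both the cone and the exponential factor, since ⟨u, x⟩ = ∑ b_i ⟨u,
v_i⟩. The determinant is the Jacobian. -/
theorem IsGeneric.integral_cone {Δ : SimplicialMultiFan n d} {x : Fin n → ℝ}
    (hx : Δ.IsGeneric x) (hI : I ∈ Δ.top) (c : Fin d → ℝ) {t : ℝ} (ht : t < 0) :
    Integrable (fun u : Fin n → ℝ =>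
      (∏ i ∈ I, (signedHalfLine (Δ.dualVec I i ⬝ᵥ x) (u ⬝ᵥ Δ.vR i - c i) : ℝ)) *
        Real.exp (t * (u ⬝ᵥ x))) ∧
    ∫ u : Fin n → ℝ,
      (∏ i ∈ I, (signedHalfLine (Δ.dualVec I i ⬝ᵥ x) (u ⬝ᵥ Δ.vR i - c i) : ℝ)) *
        Real.exp (t * (u ⬝ᵥ x)) =
      |((Δ.coneMatrix hI).det : ℝ)|⁻¹ *
        ∏ i ∈ I, Real.exp (t * ((Δ.dualVec I i ⬝ᵥ x) * c i)) / (t * (Δ.dualVec I i ⬝ᵥ x)) := by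
  have hM : ((Δ.coneMatrix hI).map (Int.cast : ℤ → ℝ)).det ≠ 0 := by
    rw [det_coneMatrix_map]; exact_mod_cast Δ.det_coneMatrix_ne_zero hI
  let b : Fin d → ℝ := fun i => Δ.dualVec I i ⬝ᵥ x
  have hb : ∀ j, b (Δ.enum hI j) ≠ 0 := fun j =>
    hx.dualVec_dotProduct_ne_zero hI (Δ.enum hI j).2
  let φ : Fin n → ℝ → ℝ := fun j s =>
    (signedHalfLine (b (Δ.enum hI j)) (s - c (Δ.enum hI j)) : ℝ) *
      Real.exp (t * (b (Δ.enum hI j) * s))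
  have hφ := fun j => signedHalfLine_mul_exp_integral (hb j) ht (c (Δ.enum hI j))
  have key := integral_prod_mulVec hM (φ := φ) fun j => (hφ j).1
  have hf : (fun u : Fin n → ℝ =>
      (∏ i ∈ I, (signedHalfLine (Δ.dualVec I i ⬝ᵥ x) (u ⬝ᵥ Δ.vR i - c i) : ℝ)) *
        Real.exp (t * (u ⬝ᵥ x))) =
      fun u => ∏ j, φ j (((Δ.coneMatrix hI).map (Int.cast : ℤ → ℝ) *ᵥ u) j) := by
    ext u
    rw [Δ.dotProduct_eq_sum hI, mul_sum, Real.exp_sum, ← prod_mul_distrib, ← Δ.prod_enum hI]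
    refine prod_congr rfl fun j _ => ?_
    rw [Δ.coneMatrix_map_mulVec]
  rw [hf]
  refine ⟨key.1, key.2.trans ?_⟩
  rw [det_coneMatrix_map]
  congr 1
  rw [← Δ.prod_enum hI]
  exact prod_congr rfl fun j _ => (hφ j).2

end SimplicialMultiFan

end

/-! ### Geometric series, the groups G_I and their characters. -/

section

open Finset

theorem hasSum_mul_of_complex {α β : Type*} {f : α → ℂ} {g : β → ℂ} {a b : ℂ}
    (hf : HasSum f a) (hg : HasSum g b) :
    HasSum (fun p : α × β => f p.1 * g p.2) (a * b) :=
  hf.mul hg (summable_mul_of_summable_norm hf.summable.norm hg.summable.norm)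

theorem hasSum_prod_pi {n : ℕ} {f : Fin n → ℤ → ℂ} {a : Fin n → ℂ}
    (h : ∀ j, HasSum (f j) (a j)) :
    HasSum (fun m : Fin n → ℤ => ∏ j, f j (m j)) (∏ j, a j) := by
  induction n with
  | zero => simp
  | succ n ih =>
    have h0 := ih fun j => h j.succ
    have h1 := hasSum_mul_of_complex (h 0) h0
    rw [← (Fin.consEquiv fun _ => ℤ).hasSum_iff, Fin.prod_univ_succ]
    refine h1.congr_fun fun p => ?_
    rw [Function.comp_apply, Fin.prod_univ_succ]
    rfl

/-- As 0 < ε < 1, the integers on the half-line are m ≥ 1 with sign -1, or m ≤ 0 with sign 1. The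
geometric series in w⁻¹ and in w then have the same closed form. -/
theorem hasSum_signedHalfLine_mul_zpow {b ε : ℝ} {w : ℂ} (hε : 0 < ε ∧ ε < 1)
    (h1 : 0 < b → 1 < ‖w‖) (h2 : ¬ 0 < b → ‖w‖ < 1) :
    HasSum (fun m : ℤ => (signedHalfLine b ((m : ℝ) - ε) : ℂ) * w ^ (-m)) (1 / (1 - w)) := by
  by_cases hb : 0 < b
  · have hw := h1 hb
    have hw0 : w ≠ 0 := norm_pos_iff.1 (one_pos.trans hw)
    have hinj : Function.Injective fun k : ℕ => (k : ℤ) + 1 := fun a b h => by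
      simpa using h
    rw [← hinj.hasSum_iff]
    · have h3 : ‖w⁻¹‖ < 1 := by
        rw [norm_inv]; exact inv_lt_one_of_one_lt₀ hw
      have h4 := (hasSum_geometric_of_norm_lt_one h3).mul_left (-w⁻¹)
      have h5 : -w⁻¹ * (1 - w⁻¹)⁻¹ = 1 / (1 - w) := by
        have h6 : w - 1 ≠ 0 := fun h => by
          rw [sub_eq_zero.1 h] at hw; simp at hw
        have h7 : 1 - w ≠ 0 := fun h => h6 (by rw [← neg_sub, h, neg_zero])
        have h8 : 1 - w⁻¹ = (w - 1) * w⁻¹ := by rw [sub_mul, mul_inv_cancel₀ hw0, one_mul]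
        rw [h8, mul_inv, inv_inv]
        field_simp
        ring
      rw [h5] at h4
      refine h4.congr_fun fun k => ?_
      have h9 : signedHalfLine b (((k : ℤ) + 1 : ℤ) - ε) = -1 := by
        have : (0 : ℝ) ≤ (((k : ℤ) + 1 : ℤ) : ℝ) - ε := by
          push_cast
          linarith [hε.2, (Nat.cast_nonneg k : (0 : ℝ) ≤ k)]
        rw [signedHalfLine, if_pos hb, if_pos this]
      simp only [Function.comp]
      rw [h9, zpow_neg, ← Nat.cast_succ, zpow_natCast, inv_pow, pow_succ]
      push_cast
      rw [mul_inv]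
      ring
    · intro m hm
      have h9 : signedHalfLine b ((m : ℝ) - ε) = 0 := by
        have h10 : m ≤ 0 := by
          by_contra! hc
          exact hm ⟨(m - 1).toNat, by simp; omega⟩
        have h11 : (m : ℝ) ≤ 0 := by exact_mod_cast h10
        rw [signedHalfLine, if_pos hb, if_neg (by linarith [hε.1])]
      simp [h9]
  · have hw := h2 hb
    have hinj : Function.Injective fun k : ℕ => -(k : ℤ) := fun a b h => by
      simpa using h
    rw [← hinj.hasSum_iff]
    · have h4 := hasSum_geometric_of_norm_lt_one hw
      rw [← one_div] at h4
      refine h4.congr_fun fun k => ?_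
      have h9 : signedHalfLine b ((-(k : ℤ) : ℤ) - ε) = 1 := by
        have : ((-(k : ℤ) : ℤ) : ℝ) - ε ≤ 0 := by
          push_cast
          linarith [hε.1, (Nat.cast_nonneg k : (0 : ℝ) ≤ k)]
        rw [signedHalfLine, if_neg hb, if_pos this]
      simp only [Function.comp]
      rw [h9]
      simp
    · intro m hm
      have h9 : signedHalfLine b ((m : ℝ) - ε) = 0 := by
        have h10 : 1 ≤ m := by
          by_contra! hc
          exact hm ⟨(-m).toNat, by simp; omega⟩
        have h11 : (1 : ℝ) ≤ m := by exact_mod_cast h10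
        rw [signedHalfLine, if_neg hb, if_neg (by linarith [hε.2])]
      simp [h9]

/-- The index of the lattice spanned by the columns of an integer matrix. -/
theorem Matrix.card_quotient_range_mulVecLin {n : ℕ} (M : Matrix (Fin n) (Fin n) ℤ)
    (hM : M.det ≠ 0) :
    Nat.card ((Fin n → ℤ) ⧸ LinearMap.range M.mulVecLin) = M.det.natAbs := by
  have hinj : Function.Injective M.mulVecLin := Matrix.mulVec_injective_of_det_ne_zero hM
  have h := Submodule.natAbs_det_equiv (LinearMap.range M.mulVecLin)
    (LinearEquiv.ofInjective M.mulVecLin hinj)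
  rw [← h]
  congr 1
  rw [← LinearMap.det_toLin' M]
  rfl

namespace SimplicialMultiFan

variable {n d : ℕ} (Δ : SimplicialMultiFan n d) {I : Finset (Fin d)}

open Classical in
/-- The homomorphism `N → ℝᵈ / ℤᵈ` with image `G_I`. -/
noncomputable def latticeToTorus (I : Finset (Fin d)) :
    (Fin n → ℤ) →+ (Fin d → AddCircle (1 : ℝ)) where
  toFun y i := if i ∈ I then ((Δ.dualVec I i ⬝ᵥ fun k => (y k : ℝ) : ℝ) : AddCircle (1 : ℝ)) else 0
  map_zero' := by
    ext i
    simp [dotProduct]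
  map_add' y z := by
    ext i
    by_cases hi : i ∈ I
    · simp only [hi, if_true, Pi.add_apply, Int.cast_add]
      rw [← AddCircle.coe_add, ← dotProduct_add]
      rfl
    · simp [hi]

theorem coe_range_latticeToTorus (hI : I ∈ Δ.top) :
    ((Δ.latticeToTorus I).range : Set (Fin d → AddCircle (1 : ℝ))) = Δ.G I := by
  classical
  ext g
  constructor
  · rintro ⟨y, rfl⟩
    refine ⟨fun i => if i ∈ I then Δ.dualVec I i ⬝ᵥ (fun k => (y k : ℝ)) else 0, ⟨y, ?_⟩,
      fun j hj => if_neg hj, ?_⟩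
    · conv_rhs => rw [Δ.eq_sum_dualVec_dotProduct_smul hI fun k => (y k : ℝ)]
      simp [ite_smul, sum_ite_mem]
    · ext i
      simp only [latticeToTorus, AddMonoidHom.coe_mk, ZeroHom.coe_mk]
      split_ifs <;> simp
  · rintro ⟨a, ⟨y, hy⟩, ha, rfl⟩
    refine ⟨y, ?_⟩
    ext i
    simp only [latticeToTorus, AddMonoidHom.coe_mk, ZeroHom.coe_mk]
    split_ifs with hi
    · rw [← hy, ← sum_subset (subset_univ I) fun j _ hj => by rw [ha j hj, zero_smul],
        Δ.dualVec_dotProduct_sum (Δ.mem_Sig_of_mem_top hI) a hi]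
    · simp [ha i hi]

/-- The coordinates of a lattice vector in the basis (v_i) are all integers exactly when it lies in
the sublattice these v_i generate. -/
theorem ker_latticeToTorus (hI : I ∈ Δ.top) :
    (Δ.latticeToTorus I).ker =
      (LinearMap.range ((Δ.coneMatrix hI)ᵀ).mulVecLin).toAddSubgroup := by
  classical
  have hsum : ∀ k : Fin n → ℤ, (fun l => (((Δ.coneMatrix hI)ᵀ *ᵥ k) l : ℝ)) =
      ∑ j, (k j : ℝ) • Δ.vR (Δ.enum hI j) := by
    intro k
    ext l
    simp [Matrix.mulVec, dotProduct, coneMatrix, vR, mul_comm]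
  ext y
  rw [AddMonoidHom.mem_ker]
  constructor
  · intro h
    have h1 : ∀ j : Fin n, ∃ k : ℤ,
        (k : ℝ) = Δ.dualVec I (Δ.enum hI j) ⬝ᵥ fun k => (y k : ℝ) := by
      intro j
      have h2 := congrFun h (Δ.enum hI j)
      simp only [latticeToTorus, AddMonoidHom.coe_mk, ZeroHom.coe_mk, (Δ.enum hI j).2, if_true,
        Pi.zero_apply] at h2
      obtain ⟨k, hk⟩ := (AddCircle.coe_eq_zero_iff (1 : ℝ)).1 h2
      exact ⟨k, by simpa using hk⟩
    choose k hk using h1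
    refine ⟨k, ?_⟩
    have h3 := hsum k
    simp only [hk] at h3
    rw [Δ.sum_enum hI (fun i => (Δ.dualVec I i ⬝ᵥ fun k => (y k : ℝ)) • Δ.vR i),
      ← Δ.eq_sum_dualVec_dotProduct_smul hI] at h3
    ext l
    have h4 := congrFun h3 l
    exact_mod_cast h4
  · rintro ⟨k, rfl⟩
    ext i
    simp only [latticeToTorus, AddMonoidHom.coe_mk, ZeroHom.coe_mk, Pi.zero_apply]
    split_ifs with hi
    · rw [AddCircle.coe_eq_zero_iff]
      obtain ⟨j, hj⟩ := (Δ.enum hI).surjective ⟨i, hi⟩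
      refine ⟨k j, ?_⟩
      rw [Matrix.mulVecLin_apply, hsum, dotProduct_sum, sum_eq_single j]
      · rw [dotProduct_smul, hj, Δ.dualVec_spec (Δ.mem_Sig_of_mem_top hI) i hi i hi]
        simp
      · intro j' _ hne
        rw [dotProduct_smul,
          Δ.dualVec_spec (Δ.mem_Sig_of_mem_top hI) i hi _ (Δ.enum hI j').2, if_neg, smul_zero]
        intro h
        refine hne ((Δ.enum hI).injective (Subtype.ext ?_))
        rw [hj, ← h]
      · simp
    · rfl

/-- G_I is the quotient of N by the sublattice generated by the v_i, i ∈ I, whose index is |det|. So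
the Jacobian of the integrals is also the order of the group in the character sums. -/
theorem natCard_G (hI : I ∈ Δ.top) : Nat.card (Δ.G I) = (Δ.coneMatrix hI).det.natAbs := by
  rw [← Δ.coe_range_latticeToTorus hI, ← Matrix.det_transpose,
    ← Matrix.card_quotient_range_mulVecLin _
      (by rw [Matrix.det_transpose]; exact Δ.det_coneMatrix_ne_zero hI)]
  refine (Nat.card_congr
    (QuotientAddGroup.quotientKerEquivRange (Δ.latticeToTorus I)).toEquiv).symm.trans ?_
  rw [Δ.ker_latticeToTorus hI]
  rfl

theorem finite_G (hI : I ∈ Δ.top) : (Δ.G I).Finite := by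
  have h : Nat.card (Δ.G I) ≠ 0 := by
    rw [Δ.natCard_G hI]
    exact Int.natAbs_ne_zero.2 (Δ.det_coneMatrix_ne_zero hI)
  exact (Nat.finite_of_card_ne_zero h)

theorem finite_GAll : Δ.GAll.Finite :=
  Set.Finite.biUnion (finite_toSet Δ.top) fun _ hI => Δ.finite_G hI

/-- The characters of `G_I` given by integer vectors. -/
noncomputable def torusChar (hI : I ∈ Δ.top) (m : Fin n → ℤ) :
    AddChar (Δ.latticeToTorus I).range ℂ where
  toFun g := ∏ j, rho (Δ.enum hI j).1 g.1 ^ (-m j)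
  map_zero_eq_one' := by simp [rho]
  map_add_eq_mul' g h := by
    rw [← prod_mul_distrib]
    refine prod_congr rfl fun j _ => ?_
    rw [← mul_zpow]
    simp [rho, AddCircle.toCircle_add]

theorem torusChar_apply (hI : I ∈ Δ.top) (m y : Fin n → ℤ) :
    Δ.torusChar hI m ⟨Δ.latticeToTorus I y, y, rfl⟩ =
      AddCircle.toCircle (T := (1 : ℝ)) ((-((∑ j, (m j : ℝ) • Δ.dualVec I (Δ.enum hI j)) ⬝ᵥ
        fun k => (y k : ℝ)) : ℝ) : AddCircle (1 : ℝ)) := by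
  change ∏ j, rho (Δ.enum hI j).1 (Δ.latticeToTorus I y) ^ (-m j) = _
  rw [sum_dotProduct, ← sum_neg_distrib, AddCircle.toCircle_apply_mk]
  rw [mul_sum, Circle.coe_exp]
  push_cast
  rw [sum_mul, Complex.exp_sum]
  refine prod_congr rfl fun j _ => ?_
  simp only [rho, latticeToTorus, AddMonoidHom.coe_mk, ZeroHom.coe_mk, (Δ.enum hI j).2, if_true]
  rw [AddCircle.toCircle_apply_mk, Circle.coe_exp, ← Complex.exp_int_mul, smul_dotProduct]
  congr 1
  push_cast
  rw [smul_eq_mul]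
  push_cast
  ring

/-- The character is y ↦ e^{-2πi⟨∑ m_j u_j^I, y⟩}, trivial exactly when ∑ m_j u_j^I lies in N*. Then
m is the vector of pairings of this point with the v_i. Here `0` is the trivial character. -/
theorem torusChar_eq_zero_iff (hI : I ∈ Δ.top) (m : Fin n → ℤ) :
    Δ.torusChar hI m = 0 ↔ ∃ u, Δ.coneMatrix hI *ᵥ u = m := by
  classical
  have hS := Δ.mem_Sig_of_mem_top hI
  have hval : ∀ u : Fin n → ℤ, ∀ j, ((Δ.coneMatrix hI *ᵥ u) j : ℝ) =
      (fun k => (u k : ℝ)) ⬝ᵥ Δ.vR (Δ.enum hI j) := by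
    intro u j
    simp [Matrix.mulVec, dotProduct, coneMatrix, vR, mul_comm]
  have hdual : ∀ j, (∑ j, (m j : ℝ) • Δ.dualVec I (Δ.enum hI j)) ⬝ᵥ Δ.vR (Δ.enum hI j) = m j := by
    intro j
    rw [sum_dotProduct, sum_eq_single j]
    · rw [smul_dotProduct, Δ.dualVec_spec hS _ (Δ.enum hI j).2 _ (Δ.enum hI j).2]
      simp
    · intro j' _ hne
      rw [smul_dotProduct, Δ.dualVec_spec hS _ (Δ.enum hI j').2 _ (Δ.enum hI j).2, if_neg,
        smul_zero]
      exact fun h => hne ((Δ.enum hI).injective (Subtype.ext h))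
    · simp
  constructor
  · intro h
    have h1 : ∀ k : Fin n, ∃ z : ℤ,
        (z : ℝ) = (∑ j, (m j : ℝ) • Δ.dualVec I (Δ.enum hI j)) k := by
      intro k
      -- Testing on the standard basis of N shows that each coordinate of ∑ m_j u_j^I is an integer.
      have h2 := DFunLike.congr_fun h ⟨Δ.latticeToTorus I (Pi.single k 1), _, rfl⟩
      rw [torusChar_apply, AddChar.zero_apply, Circle.coe_eq_one, ← AddCircle.toCircle_zero] at h2
      have h3 := AddCircle.injective_toCircle one_ne_zero h2
      obtain ⟨z, hz⟩ := (AddCircle.coe_eq_zero_iff (1 : ℝ)).1 h3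
      have h4 : (fun l => ((Pi.single k 1 : Fin n → ℤ) l : ℝ)) = Pi.single k 1 := by
        ext l
        by_cases hl : l = k
        · subst hl; simp
        · simp [hl]
      rw [h4, dotProduct_single, mul_one] at hz
      refine ⟨-z, ?_⟩
      rw [zsmul_eq_mul, mul_one] at hz
      push_cast
      rw [hz, neg_neg]
    choose z hz using h1
    refine ⟨z, ?_⟩
    ext j
    have h5 := hval z j
    rw [funext hz, hdual] at h5
    exact_mod_cast h5
  · rintro ⟨u, rfl⟩
    have hu : (∑ j, ((Δ.coneMatrix hI *ᵥ u) j : ℝ) • Δ.dualVec I (Δ.enum hI j)) =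
        fun k => (u k : ℝ) := by
      refine Δ.eq_of_dotProduct_vR_eq hI fun i hi => ?_
      obtain ⟨j, hj⟩ := (Δ.enum hI).surjective ⟨i, hi⟩
      have hj' : i = (Δ.enum hI j).1 := by rw [hj]
      rw [hj', ← hval u j]
      rw [sum_dotProduct, sum_eq_single j]
      · rw [smul_dotProduct, Δ.dualVec_spec hS _ (Δ.enum hI j).2 _ (Δ.enum hI j).2]
        simp
      · intro j' _ hne
        rw [smul_dotProduct, Δ.dualVec_spec hS _ (Δ.enum hI j').2 _ (Δ.enum hI j).2, if_neg,
          smul_zero]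
        exact fun h => hne ((Δ.enum hI).injective (Subtype.ext h))
      · simp
    ext ⟨_, y, rfl⟩
    rw [torusChar_apply, AddChar.zero_apply, Circle.coe_eq_one, ← AddCircle.toCircle_zero, hu]
    congr 1
    rw [AddCircle.coe_eq_zero_iff]
    refine ⟨-(u ⬝ᵥ y), ?_⟩
    simp [dotProduct]

open Classical in
-- Orthogonality of characters on G_I: the average over g detects which m in ℤⁿ come from a point of
-- N*.
theorem sum_torusChar (hI : I ∈ Δ.top) {F : Finset (Fin d → AddCircle (1 : ℝ))}
    (hF : ∀ g, g ∈ F ↔ g ∈ Δ.G I) (m : Fin n → ℤ) :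
    ∑ g ∈ F, ∏ j, rho (Δ.enum hI j).1 g ^ (-m j) =
      if ∃ u, Δ.coneMatrix hI *ᵥ u = m then (F.card : ℂ) else 0 := by
  have hF' : ∀ g, g ∈ F ↔ g ∈ (Δ.latticeToTorus I).range := fun g => by
    rw [hF, ← Δ.coe_range_latticeToTorus hI]; rfl
  let _ : Fintype (Δ.latticeToTorus I).range := Fintype.subtype F hF'
  have h1 : F.card = Fintype.card (Δ.latticeToTorus I).range :=
    (Fintype.subtype_card F hF').symm
  rw [Finset.sum_subtype F hF', h1]
  have h := AddChar.sum_eq_ite (Δ.torusChar hI m)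
  simp only [Δ.torusChar_eq_zero_iff] at h
  exact h

/-- The sum of an absolutely convergent series over the lattice `M ℤⁿ`, by averaging over the
characters of `G_I`. -/
theorem hasSum_comp_coneMatrix (hI : I ∈ Δ.top) {F : Finset (Fin d → AddCircle (1 : ℝ))}
    (hF : ∀ g, g ∈ F ↔ g ∈ Δ.G I) {f : (Fin n → ℤ) → ℂ} {a : (Fin d → AddCircle (1 : ℝ)) → ℂ}
    (hf : ∀ g ∈ F, HasSum (fun m => f m * ∏ j, rho (Δ.enum hI j).1 g ^ (-m j)) (a g)) :
    HasSum (fun u => f (Δ.coneMatrix hI *ᵥ u)) ((F.card : ℂ)⁻¹ * ∑ g ∈ F, a g) := by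
  classical
  have hcard : (F.card : ℂ) ≠ 0 := by
    have h0 : (0 : Fin d → AddCircle (1 : ℝ)) ∈ F := by
      rw [hF, ← Δ.coe_range_latticeToTorus hI]; exact zero_mem _
    exact Nat.cast_ne_zero.2 (card_ne_zero_of_mem h0)
  have h1 := (hasSum_sum hf).mul_left (F.card : ℂ)⁻¹
  have h2 : (fun m => (F.card : ℂ)⁻¹ *
      ∑ g ∈ F, f m * ∏ j, rho (Δ.enum hI j).1 g ^ (-m j)) =
      fun m => if ∃ u, Δ.coneMatrix hI *ᵥ u = m then f m else 0 := by
    ext m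
    rw [← mul_sum, Δ.sum_torusChar hI hF m]
    split_ifs
    · field_simp
    · simp
  rw [h2] at h1
  have hinj : Function.Injective fun u => Δ.coneMatrix hI *ᵥ u :=
    Matrix.mulVec_injective_of_det_ne_zero (Δ.det_coneMatrix_ne_zero hI)
  rw [← hinj.hasSum_iff] at h1
  · refine h1.congr_fun fun u => ?_
    simp
  · intro m hm
    exact if_neg fun ⟨u, hu⟩ => hm ⟨u, hu⟩

end SimplicialMultiFan

end

/-! ### Exponential sums over the lattice points of a vertex cone, and the Todd series. -/

section

open Finset

namespace SimplicialMultiFan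

variable {n d : ℕ} (Δ : SimplicialMultiFan n d) {I : Finset (Fin d)}

theorem norm_rho (i : Fin d) (g : Fin d → AddCircle (1 : ℝ)) : ‖rho i g‖ = 1 :=
  Circle.norm_coe _

/-- Pairing with the v_i embeds N* in ℤⁿ as a sublattice. Averaging over G_I extends the sum to all
of ℤⁿ, twisted by a character, where it factors into geometric series. -/
theorem IsGeneric.hasSum_cone {Δ : SimplicialMultiFan n d} {x : Fin n → ℝ}
    (hx : Δ.IsGeneric x) (hI : I ∈ Δ.top) {F : Finset (Fin d → AddCircle (1 : ℝ))}
    (hF : ∀ g, g ∈ F ↔ g ∈ Δ.G I) (u₀ : Fin n → ℤ) {c ε : Fin d → ℝ}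
    (hc : ∀ i ∈ I, (fun k => (u₀ k : ℝ)) ⬝ᵥ Δ.vR i = c i) (hε : ∀ i, 0 < ε i ∧ ε i < 1)
    {t : ℝ} (ht : t < 0) :
    HasSum (fun u : Fin n → ℤ =>
      (∏ i ∈ I, (signedHalfLine (Δ.dualVec I i ⬝ᵥ x)
        ((fun k => (u k : ℝ)) ⬝ᵥ Δ.vR i - (c i + ε i)) : ℂ)) *
        Complex.exp (t * ((fun k => (u k : ℝ)) ⬝ᵥ x : ℝ)))
      ((F.card : ℂ)⁻¹ * ∑ g ∈ F, ∏ i ∈ I,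
        (Complex.exp (t * ((Δ.dualVec I i ⬝ᵥ x : ℝ) * c i)) *
          (1 / (1 - rho i g * Complex.exp (-(t * (Δ.dualVec I i ⬝ᵥ x : ℝ))))))) := by
  set b : Fin d → ℝ := fun i => Δ.dualVec I i ⬝ᵥ x with hb
  have hb0 : ∀ i ∈ I, b i ≠ 0 := fun i hi => hx.dualVec_dotProduct_ne_zero hI hi
  let f : (Fin n → ℤ) → ℂ := fun m => ∏ j,
    ((signedHalfLine (b (Δ.enum hI j)) ((m j : ℝ) - ε (Δ.enum hI j)) : ℂ) *
      Complex.exp (t * (b (Δ.enum hI j) * (m j + c (Δ.enum hI j)))))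
  have hf : ∀ g ∈ F, HasSum (fun m => f m * ∏ j, rho (Δ.enum hI j).1 g ^ (-m j))
      (∏ i ∈ I, (Complex.exp (t * ((b i : ℝ) * c i)) *
          (1 / (1 - rho i g * Complex.exp (-(t * (b i : ℝ))))))) := by
    intro g _
    have h1 : ∀ j, HasSum (fun m : ℤ => Complex.exp (t * (b (Δ.enum hI j) * c (Δ.enum hI j))) *
        ((signedHalfLine (b (Δ.enum hI j)) ((m : ℝ) - ε (Δ.enum hI j)) : ℂ) *
          (rho (Δ.enum hI j).1 g * Complex.exp (-(t * b (Δ.enum hI j)))) ^ (-m)))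
        (Complex.exp (t * (b (Δ.enum hI j) * c (Δ.enum hI j))) *
          (1 / (1 - rho (Δ.enum hI j).1 g * Complex.exp (-(t * b (Δ.enum hI j)))))) := by
      intro j
      have hn : ‖rho (Δ.enum hI j).1 g * Complex.exp (-(t * b (Δ.enum hI j)))‖ =
          Real.exp (-(t * b (Δ.enum hI j))) := by
        rw [norm_mul, norm_rho, one_mul, Complex.norm_exp]
        simp
      refine (hasSum_signedHalfLine_mul_zpow (hε _) ?_ ?_).mul_left _
      · intro hpos
        rw [hn, Real.one_lt_exp_iff]
        nlinarith
      · intro hneg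
        rw [hn, Real.exp_lt_one_iff]
        have := lt_of_le_of_ne (not_lt.1 hneg) (hb0 _ (Δ.enum hI j).2)
        nlinarith
    have h2 := hasSum_prod_pi h1
    rw [Δ.prod_enum hI fun i => Complex.exp (t * ((b i : ℝ) * c i)) *
          (1 / (1 - rho i g * Complex.exp (-(t * (b i : ℝ)))))] at h2
    refine h2.congr_fun fun m => ?_
    rw [← prod_mul_distrib]
    refine prod_congr rfl fun j _ => ?_
    rw [mul_zpow, ← Complex.exp_int_mul, mul_add, mul_add, Complex.exp_add]
    have h3 : ((-m j : ℤ) : ℂ) * -(t * b (Δ.enum hI j)) = t * (b (Δ.enum hI j) * m j) := by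
      push_cast; ring
    rw [h3]
    ring
  have h4 := Δ.hasSum_comp_coneMatrix hI hF hf
  -- Recentring at the vertex is a bijection of N* because the vertex `u₀` is a lattice point.
  rw [← (Equiv.subRight u₀).hasSum_iff] at h4
  refine h4.congr_fun fun u => ?_
  have hval : ∀ u : Fin n → ℤ, ∀ j, ((Δ.coneMatrix hI *ᵥ u) j : ℝ) =
      (fun k => (u k : ℝ)) ⬝ᵥ Δ.vR (Δ.enum hI j) := by
    intro u j
    simp [Matrix.mulVec, dotProduct, coneMatrix, vR, mul_comm]
  have hm : ∀ j, ((Δ.coneMatrix hI *ᵥ (u - u₀)) j : ℝ) =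
      (fun k => (u k : ℝ)) ⬝ᵥ Δ.vR (Δ.enum hI j) - c (Δ.enum hI j) := by
    intro j
    rw [Matrix.mulVec_sub, Pi.sub_apply, Int.cast_sub, hval, hval, hc _ (Δ.enum hI j).2]
  simp only [Function.comp_apply, Equiv.subRight_apply, f]
  rw [Δ.dotProduct_eq_sum hI, Complex.ofReal_sum, mul_sum, Complex.exp_sum, ← prod_mul_distrib,
    ← Δ.prod_enum hI]
  refine prod_congr rfl fun j _ => ?_
  rw [hm j, ← Complex.ofReal_intCast ((Δ.coneMatrix hI *ᵥ (u - u₀)) j), hm j, sub_sub,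
    ← Complex.ofReal_add, sub_add_cancel, Complex.ofReal_mul]

end SimplicialMultiFan

theorem rescale_expNeg (b : ℂ) :
    PowerSeries.rescale b expNeg = PowerSeries.rescale (-b) (PowerSeries.exp ℂ) := by
  ext k
  rw [PowerSeries.coeff_rescale, PowerSeries.coeff_rescale, PowerSeries.coeff_exp, expNeg,
    PowerSeries.coeff_mk, neg_pow b]
  simp
  ring

open Filter Topology in
/-- The Maclaurin expansion of `b t / (1 - ρ e^{-b t})` is `toddSeries ρ` at `b t`. -/
theorem hasAsymp_todd {ρ : ℂ} (hρ : ‖ρ‖ = 1) {b : ℝ} (hb : b ≠ 0) :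
    HasAsymp (fun t : ℝ => (b : ℂ) * t * (1 / (1 - ρ * Complex.exp (-(t * b)))))
      (PowerSeries.rescale (b : ℂ) (toddSeries ρ)) := by
  have hspec : PowerSeries.rescale (b : ℂ) (toddSeries ρ) *
      (1 - PowerSeries.C ρ * PowerSeries.rescale (-b : ℂ) (PowerSeries.exp ℂ)) =
      PowerSeries.C (b : ℂ) * PowerSeries.X ^ 1 := by
    have h := congrArg (PowerSeries.rescale (b : ℂ)) (toddSeries_spec ρ)
    rw [map_mul, map_sub, map_one, map_mul, rescale_expNeg, PowerSeries.rescale_X] at h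
    have hC : PowerSeries.rescale (b : ℂ) (PowerSeries.C ρ) = PowerSeries.C ρ := by
      ext k
      rw [PowerSeries.coeff_rescale, PowerSeries.coeff_C]
      split_ifs with hk <;> simp [hk]
    rw [hC] at h
    rw [h, pow_one]
  refine HasAsymp.of_mul (g := fun t : ℝ => 1 - ρ * Complex.exp (-b * t))
    (γ := 1 - PowerSeries.C ρ * PowerSeries.rescale (-b : ℂ) (PowerSeries.exp ℂ)) ?_ ?_ ?_
  · rw [hspec]
    refine (HasAsymp.const_mul_pow (b : ℂ) 1).congr ?_
    filter_upwards [self_mem_nhdsWithin] with t ht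
    have ht0 : t ≠ 0 := ne_of_lt ht
    -- For t ≠ 0 the product has modulus e^{-bt} ≠ 1, so the denominator cannot vanish.
    have h1 : 1 - ρ * Complex.exp (-b * t) ≠ 0 := by
      intro h
      have h2 : ‖ρ * Complex.exp (-b * t)‖ = 1 := by
        rw [← sub_eq_zero.1 h, norm_one]
      rw [norm_mul, hρ, one_mul, Complex.norm_exp, Real.exp_eq_one_iff] at h2
      have h3 : -b * t = 0 := by simpa using h2
      exact (mul_ne_zero (neg_ne_zero.2 hb) ht0) h3
    have h4 : -((t : ℂ) * b) = -b * t := by ring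
    rw [h4, mul_assoc, one_div, inv_mul_cancel₀ h1]
    simp
  · have h := (HasAsymp.const 1).sub ((HasAsymp.const ρ).mul (HasAsymp.exp (-b : ℂ)))
    simpa using h
  · intro h0
    rw [h0, mul_zero] at hspec
    have h1 := congrArg (PowerSeries.coeff 1) hspec
    rw [PowerSeries.coeff_C_mul, PowerSeries.coeff_X_pow_self, map_zero, mul_one] at h1
    exact hb (by exact_mod_cast h1.symm)

end

/-! ### The Todd operator on powers of affine forms. -/

section

open Finset

theorem PowerSeries.coeff_prod_univ {ι R : Type*} [Fintype ι] [DecidableEq ι] [CommSemiring R]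
    (f : ι → PowerSeries R) (k : ℕ) :
    PowerSeries.coeff k (∏ i, f i) =
      ∑ α ∈ piAntidiag univ k, ∏ i, PowerSeries.coeff (α i) (f i) := by
  rw [PowerSeries.coeff_prod]
  refine sum_bij' (fun l _ => (l : ι → ℕ)) (fun α _ => Finsupp.equivFunOnFinite.symm α)
    ?_ ?_ ?_ ?_ ?_
  · intro l hl
    rw [mem_finsuppAntidiag] at hl
    rw [mem_piAntidiag]
    exact ⟨hl.1, fun i _ => mem_univ i⟩
  · intro α hα
    rw [mem_piAntidiag] at hα
    rw [mem_finsuppAntidiag]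
    exact ⟨hα.1, subset_univ _⟩
  · intro l _
    ext i
    rfl
  · intro α _
    rfl
  · intro l _
    rfl

theorem multiDeriv_eq_linearMap {d : ℕ} (α : Fin d → ℕ) :
    ∃ D : MvPolynomial (Fin d) ℂ →ₗ[ℂ] MvPolynomial (Fin d) ℂ, ∀ p, multiDeriv α p = D p := by
  unfold multiDeriv
  induction List.finRange d with
  | nil => exact ⟨LinearMap.id, fun p => rfl⟩
  | cons i l ih =>
    obtain ⟨D, hD⟩ := ih
    refine ⟨((MvPolynomial.pderiv i).toLinearMap ^ α i) ∘ₗ D, fun p => ?_⟩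
    rw [List.foldr_cons, hD, LinearMap.comp_apply, Module.End.pow_apply]
    rfl

section LinearForm

variable {d : ℕ} {R : Type*} [CommRing R] (ℓ : R) (β : Fin d → R)

/-- The polynomial `ℓ + ∑ β_i X_i`. -/
noncomputable def affineForm : MvPolynomial (Fin d) R :=
  MvPolynomial.C ℓ + ∑ i, MvPolynomial.C (β i) * MvPolynomial.X i

theorem pderiv_affineForm (i : Fin d) :
    MvPolynomial.pderiv i (affineForm ℓ β) = MvPolynomial.C (β i) := by
  classical
  unfold affineForm
  rw [map_add, MvPolynomial.pderiv_C, zero_add, map_sum, sum_eq_single i]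
  · rw [MvPolynomial.pderiv_C_mul, MvPolynomial.pderiv_X_self, mul_one]
  · intro j _ hj
    rw [MvPolynomial.pderiv_C_mul, MvPolynomial.pderiv_X_of_ne hj, mul_zero]
  · simp

theorem iterate_pderiv_affineForm_pow (i : Fin d) (c : R) (m k : ℕ) :
    (fun r => MvPolynomial.pderiv i r)^[k] (MvPolynomial.C c * affineForm ℓ β ^ m) =
      MvPolynomial.C (c * β i ^ k * m.descFactorial k) * affineForm ℓ β ^ (m - k) := by
  induction k with
  | zero => simp
  | succ k ih =>
    rw [Function.iterate_succ_apply', ih, MvPolynomial.pderiv_C_mul, MvPolynomial.pderiv_pow,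
      pderiv_affineForm, Nat.descFactorial_succ, Nat.sub_sub]
    simp only [map_mul, map_pow, map_natCast]
    push_cast
    ring

theorem eval_affineForm (h : Fin d → R) :
    MvPolynomial.eval h (affineForm ℓ β) = ℓ + ∑ i, β i * h i := by
  simp [affineForm]

theorem map_affineForm {S : Type*} [CommRing S] (φ : R →+* S) :
    MvPolynomial.map φ (affineForm ℓ β) = affineForm (φ ℓ) fun i => φ (β i) := by
  simp [affineForm]

end LinearForm

section ComplexLinearForm

variable {d : ℕ} (ℓ : ℂ) (β : Fin d → ℂ)

theorem multiDeriv_affineForm_pow (α : Fin d → ℕ) (m : ℕ) :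
    multiDeriv α (affineForm ℓ β ^ m) =
      MvPolynomial.C ((∏ i, β i ^ α i) * m.descFactorial (∑ i, α i)) *
        affineForm ℓ β ^ (m - ∑ i, α i) := by
  rw [Fin.prod_univ_def, Fin.sum_univ_def]
  unfold multiDeriv
  induction List.finRange d with
  | nil => simp
  | cons i l ih =>
    rw [List.foldr_cons, ih, iterate_pderiv_affineForm_pow, List.map_cons, List.map_cons,
      List.prod_cons, List.sum_cons, Nat.sub_sub, add_comm (α i)]
    congr 2
    have h := Nat.descFactorial_mul_descFactorial (n := m)
      (Nat.le_add_right (l.map fun i => α i).sum (α i))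
    rw [Nat.add_sub_cancel_left] at h
    rw [← h]
    push_cast
    ring

/-- The falling factorial of n of order k is n!/(n-k)!, and ℓ^{n-k}/(n-k)! is a coefficient of
e^{ℓX}. So the derivatives of the n-th power of an affine form at 0 assemble into one Cauchy
product. -/
theorem coeff_prod_rescale_mul_exp (τ : Fin d → PowerSeries ℂ) (n : ℕ) :
    ∑ k ∈ range (n + 1), ∑ α ∈ piAntidiag univ k, (∏ i, PowerSeries.coeff (α i) (τ i)) *
      ((∏ i, β i ^ α i) * n.descFactorial (∑ i, α i) * ℓ ^ (n - ∑ i, α i)) =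
    n.factorial * PowerSeries.coeff n ((∏ i, PowerSeries.rescale (β i) (τ i)) *
      PowerSeries.rescale ℓ (PowerSeries.exp ℂ)) := by
  rw [PowerSeries.coeff_mul, Finset.Nat.sum_antidiagonal_eq_sum_range_succ_mk, mul_sum]
  refine sum_congr rfl fun k hk => ?_
  have hkn : k ≤ n := Nat.lt_succ_iff.1 (mem_range.1 hk)
  have h0 : ((n - k).factorial : ℂ) ≠ 0 := Nat.cast_ne_zero.2 (Nat.factorial_ne_zero _)
  rw [PowerSeries.coeff_prod_univ, sum_mul, mul_sum]
  refine sum_congr rfl fun α hα => ?_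
  rw [(mem_piAntidiag.1 hα).1, PowerSeries.coeff_rescale, PowerSeries.coeff_exp]
  simp only [PowerSeries.coeff_rescale, prod_mul_distrib]
  rw [← Nat.factorial_mul_descFactorial hkn]
  push_cast
  simp
  field_simp

end ComplexLinearForm

theorem eval_zero_finsum_multiDeriv {d n : ℕ} {ι : Type*} (s : Finset ι) (a ℓ : ι → ℂ)
    (β : ι → Fin d → ℂ) (τ : Fin d → PowerSeries ℂ) :
    MvPolynomial.eval 0 (∑ᶠ α : Fin d → ℕ, (∏ i, PowerSeries.coeff (α i) (τ i)) •
      multiDeriv α (∑ I ∈ s, MvPolynomial.C (a I) * affineForm (ℓ I) (β I) ^ n)) =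
    ∑ I ∈ s, a I * (n.factorial * PowerSeries.coeff n
      ((∏ i, PowerSeries.rescale (β I i) (τ i)) *
        PowerSeries.rescale (ℓ I) (PowerSeries.exp ℂ))) := by
  classical
  have hD : ∀ α : Fin d → ℕ,
      multiDeriv α (∑ I ∈ s, MvPolynomial.C (a I) * affineForm (ℓ I) (β I) ^ n) =
      ∑ I ∈ s, a I • (MvPolynomial.C ((∏ i, β I i ^ α i) * n.descFactorial (∑ i, α i)) *
        affineForm (ℓ I) (β I) ^ (n - ∑ i, α i)) := by
    intro α
    obtain ⟨D, hD⟩ := multiDeriv_eq_linearMap α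
    rw [hD, map_sum]
    refine sum_congr rfl fun I _ => ?_
    rw [← MvPolynomial.smul_eq_C_mul, map_smul, ← hD, multiDeriv_affineForm_pow]
  have hdisj : Set.PairwiseDisjoint ((range (n + 1) : Finset ℕ) : Set ℕ)
      fun k => piAntidiag (univ : Finset (Fin d)) k := by
    intro k _ k' _ hkk'
    refine disjoint_left.2 fun α h h' => hkk' ?_
    rw [← (mem_piAntidiag.1 h).1, ← (mem_piAntidiag.1 h').1]
  rw [finsum_eq_sum_of_support_subset
    (s := (range (n + 1)).biUnion fun k => piAntidiag (univ : Finset (Fin d)) k)]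
  · rw [sum_biUnion hdisj, map_sum]
    simp only [map_sum, hD, MvPolynomial.smul_eval, map_mul, map_pow, MvPolynomial.eval_C,
      eval_affineForm, Pi.zero_apply, mul_zero, sum_const_zero, add_zero, mul_sum]
    rw [sum_congr rfl fun k _ => sum_comm, sum_comm]
    refine sum_congr rfl fun I _ => ?_
    rw [← coeff_prod_rescale_mul_exp, mul_sum]
    refine sum_congr rfl fun k _ => ?_
    rw [mul_sum]
    exact sum_congr rfl fun α _ => by ring
  · intro α hα
    rw [Finset.mem_coe, mem_biUnion]
    refine ⟨∑ i, α i, ?_, mem_piAntidiag.2 ⟨rfl, fun i _ => mem_univ i⟩⟩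
    by_contra hc
    refine hα ?_
    change _ • _ = (0 : MvPolynomial (Fin d) ℂ)
    rw [hD, sum_eq_zero, smul_zero]
    intro I _
    rw [mem_range, not_lt] at hc
    -- Derivatives of order greater than n kill the n-th power, so the sum over α is finite.
    rw [Nat.descFactorial_eq_zero_iff_lt.2 (by omega)]
    simp

theorem constantCoeff_toddSeries (ρ : ℂ) [Decidable (ρ = 1)] :
    PowerSeries.constantCoeff (toddSeries ρ) = if ρ = 1 then 1 else 0 := by
  unfold toddSeries
  split_ifs with h
  · rw [PowerSeries.constantCoeff_inv]
    simp
  · simp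

theorem rho_eq_one_iff {d : ℕ} (i : Fin d) (g : Fin d → AddCircle (1 : ℝ)) :
    rho i g = 1 ↔ g i = 0 := by
  rw [rho, Circle.coe_eq_one, ← AddCircle.toCircle_zero (T := (1 : ℝ))]
  exact (AddCircle.injective_toCircle one_ne_zero).eq_iff

namespace SimplicialMultiFan

variable {n d : ℕ} (Δ : SimplicialMultiFan n d)

/-- A representative coming from another cone has integer entries outside I. Deleting them changes
neither its class nor the integrality of ∑ a_i v_i. -/
theorem mem_G_iff {I : Finset (Fin d)} (hI : I ∈ Δ.top) (g : Fin d → AddCircle (1 : ℝ)) :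
    g ∈ Δ.G I ↔ g ∈ Δ.GAll ∧ ∀ i ∉ I, rho i g = 1 := by
  classical
  constructor
  · intro h
    refine ⟨Set.mem_biUnion hI h, fun i hi => ?_⟩
    obtain ⟨a, -, ha, rfl⟩ := h
    rw [rho_eq_one_iff, ha i hi]
    simp
  · rintro ⟨hg, h1⟩
    obtain ⟨J, hJ, a, ⟨y, hy⟩, -, rfl⟩ := Set.mem_iUnion₂.1 hg
    have h2 : ∀ i, ∃ z : ℤ, i ∉ I → a i = z := by
      intro i
      by_cases hi : i ∈ I
      · exact ⟨0, fun h => absurd hi h⟩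
      · obtain ⟨z, hz⟩ := (AddCircle.coe_eq_zero_iff (1 : ℝ)).1 ((rho_eq_one_iff i _).1 (h1 i hi))
        exact ⟨z, fun _ => by rw [← hz]; simp⟩
    choose z hz using h2
    refine ⟨fun i => if i ∈ I then a i else 0,
      ⟨y - ∑ i, (if i ∈ I then 0 else z i) • Δ.v i, ?_⟩, fun j hj => if_neg hj, ?_⟩
    · ext k
      have h3 := congrFun hy k
      simp only [Finset.sum_apply, Pi.smul_apply, Pi.sub_apply, smul_eq_mul] at h3 ⊢
      push_cast
      rw [← h3, ← sum_sub_distrib]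
      refine sum_congr rfl fun i _ => ?_
      split_ifs with hi
      · simp
      · rw [hz i hi]; simp [vR]
    · ext i
      by_cases hi : i ∈ I
      · simp [hi]
      · simp only [hi, if_false]
        rw [(rho_eq_one_iff i _).1 (h1 i hi)]
        simp

open Classical in
-- The affine form of the vertex u_I does not involve h_i for i ∉ I, so only the constant term of
-- the Todd series remains there: 1 if ρ_i(g) = 1 and 0 otherwise. The product therefore vanishes
-- unless g ∈ G_I.
theorem prod_rescale_toddSeries {I : Finset (Fin d)} (hI : I ∈ Δ.top) (b : Fin d → ℂ)
    {g : Fin d → AddCircle (1 : ℝ)} (hg : g ∈ Δ.GAll) :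
    ∏ i, PowerSeries.rescale (if i ∈ I then b i else 0) (toddSeries (rho i g)) =
      if g ∈ Δ.G I then ∏ i ∈ I, PowerSeries.rescale (b i) (toddSeries (rho i g)) else 0 := by
  have h0 : ∀ i ∉ I, PowerSeries.rescale (if i ∈ I then b i else 0) (toddSeries (rho i g)) =
      if rho i g = 1 then 1 else 0 := by
    intro i hi
    rw [if_neg hi, PowerSeries.rescale_zero_apply, constantCoeff_toddSeries]
    split_ifs <;> simp
  split_ifs with h
  · have h1 := ((Δ.mem_G_iff hI g).1 h).2
    rw [← prod_subset (subset_univ I) fun i _ hi => by rw [h0 i hi, if_pos (h1 i hi)]]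
    exact prod_congr rfl fun i hi => by rw [if_pos hi]
  · rw [Δ.mem_G_iff hI] at h
    push Not at h
    obtain ⟨i, hi, hne⟩ := h hg
    exact prod_eq_zero (mem_univ i) (by rw [h0 i hi, if_neg hne])

end SimplicialMultiFan

end

/-! ### Vertex formulas for volume and lattice count, and their comparison. -/

section

open Finset MeasureTheory Filter Topology

theorem PowerSeries.prod_rescale_exp {ι : Type*} (s : Finset ι) (a : ι → ℂ) :
    ∏ i ∈ s, PowerSeries.rescale (a i) (PowerSeries.exp ℂ) =
      PowerSeries.rescale (∑ i ∈ s, a i) (PowerSeries.exp ℂ) := by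
  classical
  induction s using Finset.induction_on with
  | empty => simp
  | insert i s hi ih =>
    rw [prod_insert hi, sum_insert hi, ih, PowerSeries.exp_mul_exp_eq_exp_add]

namespace SimplicialMultiFan

variable {n d : ℕ} (Δ : SimplicialMultiFan n d) {I : Finset (Fin d)}

theorem abs_det_coneMatrix (hI : I ∈ Δ.top) :
    |((Δ.coneMatrix hI).det : ℝ)| = Nat.card (Δ.G I) := by
  rw [Δ.natCard_G hI, Nat.cast_natAbs, Int.cast_abs]

end SimplicialMultiFan

namespace SimpleMultiPolytope

variable {n d : ℕ} (P : SimpleMultiPolytope n d)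

/-- The coefficient `w(I) / (|G_I| ∏ ⟨u_i^I, x⟩)` of the contribution of the vertex `u_I`. -/
noncomputable def vertexCoeff (x : Fin n → ℝ) (I : Finset (Fin d)) : ℝ :=
  P.fan.w I * (Nat.card (P.fan.G I) : ℝ)⁻¹ * ∏ i ∈ I, (P.fan.dualVec I i ⬝ᵥ x)⁻¹

theorem integral_DH_mul_exp {x : Fin n → ℝ} (hx : P.fan.IsGeneric x) {t : ℝ} (ht : t < 0) :
    t ^ n * ∫ u : Fin n → ℝ, (P.DH x u : ℝ) * Real.exp (t * (u ⬝ᵥ x)) =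
      ∑ I ∈ P.fan.top, P.vertexCoeff x I *
        ∏ i ∈ I, Real.exp (t * ((P.fan.dualVec I i ⬝ᵥ x) * P.c i)) := by
  have h1 : (fun u : Fin n → ℝ => (P.DH x u : ℝ) * Real.exp (t * (u ⬝ᵥ x))) =
      fun u => ∑ I ∈ P.fan.top, (P.fan.w I : ℝ) *
        ((∏ i ∈ I, (signedHalfLine (P.fan.dualVec I i ⬝ᵥ x) (u ⬝ᵥ P.fan.vR i - P.c i) : ℝ)) *
          Real.exp (t * (u ⬝ᵥ x))) := by
    ext u
    rw [DH_eq]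
    push_cast
    rw [sum_mul]
    exact sum_congr rfl fun I _ => by ring
  rw [h1, integral_finsetSum _ fun I hI => (hx.integral_cone hI P.c ht).1.const_mul _, mul_sum]
  refine sum_congr rfl fun I hI => ?_
  rw [integral_const_mul, (hx.integral_cone hI P.c ht).2, P.fan.abs_det_coneMatrix hI, vertexCoeff]
  have h3 : t ^ n = ∏ _i ∈ I, t := by
    rw [prod_const, P.fan.card_of_mem_top hI]
  rw [h3]
  have h2 : (∏ _i ∈ I, t) * ∏ i ∈ I, Real.exp (t * ((P.fan.dualVec I i ⬝ᵥ x) * P.c i)) /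
      (t * (P.fan.dualVec I i ⬝ᵥ x)) = (∏ i ∈ I, (P.fan.dualVec I i ⬝ᵥ x)⁻¹) *
        ∏ i ∈ I, Real.exp (t * ((P.fan.dualVec I i ⬝ᵥ x) * P.c i)) := by
    rw [← prod_mul_distrib, ← prod_mul_distrib]
    refine prod_congr rfl fun i hi => ?_
    have hb := hx.dualVec_dotProduct_ne_zero hI hi
    have ht0 := ht.ne
    field_simp
  linear_combination (P.fan.w I * (Nat.card (P.fan.G I) : ℝ)⁻¹) * h2

/-- Multiplied by t^n, the exponential integral is a combination of exponentials e^{t⟨u_I,x⟩}. Its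
limit as t → 0⁻ is therefore their t^n-coefficient. -/
theorem vol_eq {x : Fin n → ℝ} (hx : P.fan.IsGeneric x) :
    P.vol x = ∑ I ∈ P.fan.top, P.vertexCoeff x I *
      ((∑ i ∈ I, (P.fan.dualVec I i ⬝ᵥ x) * P.c i) ^ n / n.factorial) := by
  have hF : HasAsymp (fun t : ℝ => ∑ I ∈ P.fan.top, (P.vertexCoeff x I : ℂ) *
      ∏ i ∈ I, Complex.exp (((P.fan.dualVec I i ⬝ᵥ x : ℝ) * P.c i : ℂ) * t))
      (∑ I ∈ P.fan.top, PowerSeries.C (P.vertexCoeff x I : ℂ) *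
        ∏ i ∈ I, PowerSeries.rescale ((P.fan.dualVec I i ⬝ᵥ x : ℝ) * P.c i : ℂ)
          (PowerSeries.exp ℂ)) :=
    HasAsymp.sum fun I _ => (HasAsymp.const _).mul (HasAsymp.prod fun i _ => HasAsymp.exp _)
  have hE := (Complex.continuous_ofReal.tendsto _).comp (P.tendsto_integral_DH_mul_exp hx)
  have h := hF.eq_coeff_of_tendsto (n := n) (by
    filter_upwards [self_mem_nhdsWithin] with t ht
    rw [Function.comp_apply, ← Complex.ofReal_pow, ← Complex.ofReal_mul,
      P.integral_DH_mul_exp hx ht]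
    push_cast
    refine sum_congr rfl fun I _ => ?_
    congr 1
    refine prod_congr rfl fun i _ => ?_
    rw [mul_comm (t : ℂ)]) hE
  rw [← Complex.ofReal_inj, h, map_sum]
  push_cast
  refine sum_congr rfl fun I _ => ?_
  rw [PowerSeries.coeff_C_mul, PowerSeries.prod_rescale_exp, PowerSeries.coeff_rescale,
    PowerSeries.coeff_exp]
  simp [div_eq_mul_inv]

/-- `vol(P_h)` as a polynomial in `h`. -/
noncomputable def volPolynomial (x : Fin n → ℝ) : MvPolynomial (Fin d) ℝ :=
  open Classical in
  ∑ I ∈ P.fan.top, MvPolynomial.C (P.vertexCoeff x I / n.factorial) *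
    affineForm (∑ i ∈ I, (P.fan.dualVec I i ⬝ᵥ x) * P.c i)
      (fun i => if i ∈ I then P.fan.dualVec I i ⬝ᵥ x else 0) ^ n

theorem vol_shift_eq_eval {x : Fin n → ℝ} (hx : P.fan.IsGeneric x) (h : Fin d → ℝ) :
    (P.shift h).vol x = MvPolynomial.eval h (P.volPolynomial x) := by
  classical
  rw [(P.shift h).vol_eq hx, volPolynomial, map_sum]
  refine sum_congr rfl fun I _ => ?_
  have h1 : (∑ i ∈ I, ((P.shift h).fan.dualVec I i ⬝ᵥ x) * (P.shift h).c i) =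
      (∑ i ∈ I, (P.fan.dualVec I i ⬝ᵥ x) * P.c i) +
        ∑ i, (if i ∈ I then P.fan.dualVec I i ⬝ᵥ x else 0) * h i := by
    simp only [ite_mul, zero_mul, sum_ite_mem, univ_inter]
    rw [← sum_add_distrib]
    exact sum_congr rfl fun i _ => mul_add _ _ _
  rw [h1, map_mul, map_pow, eval_affineForm, MvPolynomial.eval_C]
  change P.vertexCoeff x I * _ = _
  ring

theorem volPolynomial_eq_of_isGeneric {x y : Fin n → ℝ} (hx : P.fan.IsGeneric x)
    (hy : P.fan.IsGeneric y) : P.volPolynomial x = P.volPolynomial y := by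
  refine MvPolynomial.funext fun h => ?_
  rw [← P.vol_shift_eq_eval hx, ← P.vol_shift_eq_eval hy]
  exact (P.shift h).vol_eq_of_isGeneric hx hy

open Classical in
theorem eval_toddOperator_volPolynomial (x : Fin n → ℝ) :
    MvPolynomial.eval 0 (toddOperator P.fan (MvPolynomial.map (algebraMap ℝ ℂ)
      (P.volPolynomial x))) =
    ∑ I ∈ P.fan.top, (P.vertexCoeff x I : ℂ) *
      ∑ g ∈ P.fan.finite_GAll.toFinset.filter (fun g => g ∈ P.fan.G I),
        PowerSeries.coeff n
          ((∏ i ∈ I, PowerSeries.rescale ((P.fan.dualVec I i ⬝ᵥ x : ℝ) : ℂ)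
            (toddSeries (rho i g))) *
          PowerSeries.rescale (∑ i ∈ I, ((P.fan.dualVec I i ⬝ᵥ x : ℝ) * P.c i : ℂ))
            (PowerSeries.exp ℂ)) := by
  have hmap : MvPolynomial.map (algebraMap ℝ ℂ) (P.volPolynomial x) =
      ∑ I ∈ P.fan.top, MvPolynomial.C ((P.vertexCoeff x I : ℂ) / n.factorial) *
        affineForm (∑ i ∈ I, ((P.fan.dualVec I i ⬝ᵥ x : ℝ) * P.c i : ℂ))
          (fun i => if i ∈ I then ((P.fan.dualVec I i ⬝ᵥ x : ℝ) : ℂ) else 0) ^ n := by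
    rw [volPolynomial, map_sum]
    refine sum_congr rfl fun I _ => ?_
    rw [map_mul, map_pow, map_affineForm, MvPolynomial.map_C]
    congr 3
    · simp
    · simp
    · ext i
      split_ifs <;> simp
  rw [toddOperator, hmap, finsum_mem_eq_finite_toFinset_sum _ P.fan.finite_GAll, map_sum]
  simp only [eval_zero_finsum_multiDeriv]
  rw [sum_comm]
  refine sum_congr rfl fun I hI => ?_
  rw [sum_filter, mul_sum]
  refine sum_congr rfl fun g hg => ?_
  rw [P.fan.prod_rescale_toddSeries hI _ (P.fan.finite_GAll.mem_toFinset.1 hg)]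
  have h0 : (n.factorial : ℂ) ≠ 0 := Nat.cast_ne_zero.2 (Nat.factorial_ne_zero _)
  split_ifs
  · field_simp
  · simp

open Classical in
theorem IsLattice.hasSum_latticeDH_mul_exp {P : SimpleMultiPolytope n d} (hP : P.IsLattice)
    {x : Fin n → ℝ} (hx : P.fan.IsGeneric x)
    {ε : Fin d → ℝ} (hε : ∀ i, 0 < ε i ∧ ε i < 1) {t : ℝ} (ht : t < 0) :
    HasSum (fun u : Fin n → ℤ => ((P.shift ε).latticeDH x u : ℂ) *
      Complex.exp (t * ((fun k => (u k : ℝ)) ⬝ᵥ x : ℝ)))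
      (∑ I ∈ P.fan.top, (P.fan.w I : ℂ) * ((Nat.card (P.fan.G I) : ℂ)⁻¹ *
        ∑ g ∈ P.fan.finite_GAll.toFinset.filter (fun g => g ∈ P.fan.G I), ∏ i ∈ I,
        (Complex.exp (t * ((P.fan.dualVec I i ⬝ᵥ x : ℝ) * P.c i)) *
          (1 / (1 - rho i g * Complex.exp (-(t * (P.fan.dualVec I i ⬝ᵥ x : ℝ)))))))) := by
  have h1 : ∀ I ∈ P.fan.top, HasSum (fun u : Fin n → ℤ => (P.fan.w I : ℂ) *
      ((∏ i ∈ I, (signedHalfLine (P.fan.dualVec I i ⬝ᵥ x)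
        ((fun k => (u k : ℝ)) ⬝ᵥ P.fan.vR i - (P.c i + ε i)) : ℂ)) *
        Complex.exp (t * ((fun k => (u k : ℝ)) ⬝ᵥ x : ℝ))))
      ((P.fan.w I : ℂ) * ((Nat.card (P.fan.G I) : ℂ)⁻¹ *
        ∑ g ∈ P.fan.finite_GAll.toFinset.filter (fun g => g ∈ P.fan.G I), ∏ i ∈ I,
        (Complex.exp (t * ((P.fan.dualVec I i ⬝ᵥ x : ℝ) * P.c i)) *
          (1 / (1 - rho i g * Complex.exp (-(t * (P.fan.dualVec I i ⬝ᵥ x : ℝ)))))))) := by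
    intro I hI
    have hF : ∀ g, g ∈ P.fan.finite_GAll.toFinset.filter (fun g => g ∈ P.fan.G I) ↔
        g ∈ P.fan.G I := fun g => by
      rw [mem_filter, Set.Finite.mem_toFinset]
      exact ⟨fun h => h.2, fun h => ⟨Set.mem_biUnion hI h, h⟩⟩
    obtain ⟨u₀, hu₀⟩ := hP I hI
    have hc : ∀ i ∈ I, (fun k => (u₀ k : ℝ)) ⬝ᵥ P.fan.vR i = P.c i := fun i hi => by
      rw [← hu₀]
      exact P.vertex_mem (P.fan.mem_Sig_of_mem_top hI) hi
    have hcard : (P.fan.finite_GAll.toFinset.filter (fun g => g ∈ P.fan.G I)).card =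
        Nat.card (P.fan.G I) := (Nat.subtype_card _ hF).symm
    have h := (hx.hasSum_cone hI hF u₀ hc hε ht).mul_left (P.fan.w I : ℂ)
    rw [hcard] at h
    exact h
  refine (hasSum_sum h1).congr_fun fun u => ?_
  rw [latticeDH, DH_eq]
  push_cast
  rw [sum_mul]
  exact sum_congr rfl fun I _ => mul_assoc _ _ _

open Classical in
-- The count is the limit at 0 of a finite exponential sum. For t < 0 that sum equals the total of
-- the vertex series; each b_i t/(1 - ρ e^{-b_i t}) expands as a Todd series, and the n factors t
-- needed come from t^n.
theorem IsLattice.count_eq {P : SimpleMultiPolytope n d} (hP : P.IsLattice)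
    {x : Fin n → ℝ} (hx : P.fan.IsGeneric x)
    {ε : Fin d → ℝ} (hε : ∀ i, 0 < ε i ∧ ε i < 1) :
    (P.count x ε : ℂ) = ∑ I ∈ P.fan.top, (P.vertexCoeff x I : ℂ) *
      ∑ g ∈ P.fan.finite_GAll.toFinset.filter (fun g => g ∈ P.fan.G I),
        PowerSeries.coeff n
          ((∏ i ∈ I, PowerSeries.rescale ((P.fan.dualVec I i ⬝ᵥ x : ℝ) : ℂ)
            (toddSeries (rho i g))) *
          PowerSeries.rescale (∑ i ∈ I, ((P.fan.dualVec I i ⬝ᵥ x : ℝ) * P.c i : ℂ))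
            (PowerSeries.exp ℂ)) := by
  have hfin := hP.finite_support_latticeDH hx hε
  let E : ℝ → ℂ := fun t => ∑ u ∈ hfin.toFinset, ((P.shift ε).latticeDH x u : ℂ) *
      Complex.exp (t * ((fun k => (u k : ℝ)) ⬝ᵥ x : ℝ))
  have hE : Tendsto E (𝓝[<] 0) (𝓝 (P.count x ε : ℂ)) := by
    have hc : Continuous E := by fun_prop
    have h0 : E 0 = (P.count x ε : ℂ) := by
      rw [count, finsum_eq_sum _ hfin]
      simp [E]
    rw [← h0]
    exact (hc.tendsto 0).mono_left nhdsWithin_le_nhds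
  have hF : HasAsymp (fun t : ℝ => ∑ I ∈ P.fan.top, (P.vertexCoeff x I : ℂ) *
      ∑ g ∈ P.fan.finite_GAll.toFinset.filter (fun g => g ∈ P.fan.G I),
        ((∏ i ∈ I, ((P.fan.dualVec I i ⬝ᵥ x : ℝ) : ℂ) * t *
          (1 / (1 - rho i g * Complex.exp (-(t * (P.fan.dualVec I i ⬝ᵥ x : ℝ)))))) *
        ∏ i ∈ I, Complex.exp (((P.fan.dualVec I i ⬝ᵥ x : ℝ) * P.c i : ℂ) * t)))
      (∑ I ∈ P.fan.top, PowerSeries.C (P.vertexCoeff x I : ℂ) *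
      ∑ g ∈ P.fan.finite_GAll.toFinset.filter (fun g => g ∈ P.fan.G I),
        (∏ i ∈ I, PowerSeries.rescale ((P.fan.dualVec I i ⬝ᵥ x : ℝ) : ℂ)
            (toddSeries (rho i g))) *
        ∏ i ∈ I, PowerSeries.rescale ((P.fan.dualVec I i ⬝ᵥ x : ℝ) * P.c i : ℂ)
          (PowerSeries.exp ℂ)) :=
    HasAsymp.sum fun I hI => (HasAsymp.const _).mul <| HasAsymp.sum fun g _ =>
      (HasAsymp.prod fun i hi => hasAsymp_todd (SimplicialMultiFan.norm_rho i g)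
        (hx.dualVec_dotProduct_ne_zero hI hi)).mul (HasAsymp.prod fun i _ => HasAsymp.exp _)
  have h := hF.eq_coeff_of_tendsto (n := n) (by
    filter_upwards [self_mem_nhdsWithin] with t ht
    have h1 := hP.hasSum_latticeDH_mul_exp hx hε ht
    have h2 : HasSum (fun u : Fin n → ℤ => ((P.shift ε).latticeDH x u : ℂ) *
      Complex.exp (t * ((fun k => (u k : ℝ)) ⬝ᵥ x : ℝ))) (E t) := by
      refine hasSum_sum_of_ne_finset_zero fun u hu => ?_
      have h3 : (P.shift ε).latticeDH x u = 0 := by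
        simpa using hu
      simp [h3]
    -- The series summed vertex by vertex and the finite sum over the support have the same terms in
    -- total, hence the same value.
    rw [h2.unique h1, mul_sum]
    refine sum_congr rfl fun I hI => ?_
    rw [mul_sum, mul_sum, mul_sum, mul_sum]
    refine sum_congr rfl fun g _ => ?_
    have h4 : (t : ℂ) ^ n = ∏ _i ∈ I, (t : ℂ) := by
      rw [prod_const, P.fan.card_of_mem_top hI]
    rw [h4, vertexCoeff]
    push_cast
    have h5 : ∀ X : Fin d → ℂ, (∏ i ∈ I, ((P.fan.dualVec I i ⬝ᵥ x : ℝ) : ℂ)⁻¹) *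
        ((∏ i ∈ I, ((P.fan.dualVec I i ⬝ᵥ x : ℝ) : ℂ) * t * X i) *
          ∏ i ∈ I, Complex.exp (((P.fan.dualVec I i ⬝ᵥ x : ℝ) * P.c i : ℂ) * t)) =
        (∏ _i ∈ I, (t : ℂ)) * ∏ i ∈ I,
          (Complex.exp (t * ((P.fan.dualVec I i ⬝ᵥ x : ℝ) * P.c i)) * X i) := by
      intro X
      simp only [← prod_mul_distrib]
      refine prod_congr rfl fun i hi => ?_
      have hb : ((P.fan.dualVec I i ⬝ᵥ x : ℝ) : ℂ) ≠ 0 :=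
        Complex.ofReal_ne_zero.2 (hx.dualVec_dotProduct_ne_zero hI hi)
      rw [mul_comm (t : ℂ) (_ * _)]
      field_simp
    have h6 := h5 fun i => 1 / (1 - rho i g * Complex.exp (-(t * (P.fan.dualVec I i ⬝ᵥ x : ℝ))))
    linear_combination -(P.fan.w I * (Nat.card (P.fan.G I) : ℂ)⁻¹) * h6) hE
  rw [h, map_sum]
  refine sum_congr rfl fun I _ => ?_
  rw [PowerSeries.coeff_C_mul, map_sum]
  simp only [PowerSeries.prod_rescale_exp]

end SimpleMultiPolytope

end

theorem theorem8p7 {n d : ℕ} (P : SimpleMultiPolytope n d) (hP : P.IsLattice) :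
    (∀ x : Fin n → ℝ, P.fan.IsGeneric x → ∀ h : Fin d → ℝ,
      MeasureTheory.Integrable (fun u : Fin n → ℝ => ((P.shift h).DH x u : ℝ))) ∧
    (∀ x : Fin n → ℝ, P.fan.IsGeneric x → ∀ ε : Fin d → ℝ, (∀ i, 0 < ε i ∧ ε i < 1) →
      (Function.support ((P.shift ε).latticeDH x)).Finite) ∧
    ∃ p : MvPolynomial (Fin d) ℝ,
      (∀ x : Fin n → ℝ, P.fan.IsGeneric x → ∀ h : Fin d → ℝ,
        (P.shift h).vol x = MvPolynomial.eval h p) ∧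
      (∀ x : Fin n → ℝ, P.fan.IsGeneric x → ∀ ε : Fin d → ℝ, (∀ i, 0 < ε i ∧ ε i < 1) →
        MvPolynomial.eval 0 (toddOperator P.fan (MvPolynomial.map (algebraMap ℝ ℂ) p)) =
          (P.count x ε : ℂ)) := by
  refine ⟨fun x hx h => (P.shift h).integrable_DH hx,
    fun x hx ε hε => hP.finite_support_latticeDH hx hε, ?_⟩
  -- The polynomial has to be chosen before x: any generic y provides it, and without generic
  -- vectors the remaining claims are vacuous.
  by_cases hex : ∃ y, P.fan.IsGeneric y
  · obtain ⟨y, hy⟩ := hex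
    refine ⟨P.volPolynomial y, fun x hx h => ?_, fun x hx ε hε => ?_⟩
    · rw [P.vol_shift_eq_eval hx, P.volPolynomial_eq_of_isGeneric hx hy]
    · rw [← P.volPolynomial_eq_of_isGeneric hx hy, P.eval_toddOperator_volPolynomial,
        hP.count_eq hx hε]
  · exact ⟨0, fun x hx => absurd ⟨x, hx⟩ hex, fun x hx => absurd ⟨x, hx⟩ hex⟩
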